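/- For integers $n\ge 0$ let $(a;q)_n=\prod_{j=0}^{n-1}(1-aq^j)$, and let the Borwein polynomials $A_n,B_n,C_n\in\mathbb{Z}[q]$ be the polynomials uniquely determined by $$A_n(q^3)-q\,B_n(q^3)-q^2\,C_n(q^3)=(q;q^3)_n\,(q^2;q^3)_n .$$ Let $L$ be a nonnegative integer and, for nonnegative integers $n_1,n_2,n_3$, write $N_1=n_1+n_2+n_3$, $N_2=n_2+n_3$, $N_3=n_3$. Then the following identities of rational functions in $q$ hold: $$A_L(q)=\sum_{\substack{n_1,n_2,n_3\ge 0\\ N_1+N_2+N_3\le L}}\frac{q^{N_1^2+N_2^2+N_3^2}\,(q;q)_{L-N_1}\,(q;q)_{2L-N_1-N_2}}{(q;q)_{2L-2N_1}\,(q;q)_{L-N_1-N_2-N_3}\,(q;q)_{n_1}\,(q;q)_{n_2}\,(q;q)_{n_3}}$$ and $$C_L(q)=\sum_{\substack{n_1,n_2,n_3\ge 0\\ N_1+N_2+N_3\le L-1}}\frac{q^{N_1^2+N_2^2+N_3^2+N_1+N_2+N_3}\,(q;q)_{L-N_1-1}\,(q;q)_{2L-N_1-N_2-1}}{(q;q)_{2L-2N_1-1}\,(q;q)_{L-N_1-N_2-N_3-1}\,(q;q)_{n_1}\,(q;q)_{n_2}\,(q;q)_{n_3}},$$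 where for $L=0$ the second sum is empty and equals $0$. -/

import Mathlib

open Polynomial

/-- The `q`-shifted factorial `(a; q)_n = ∏_{j=0}^{n-1} (1 - a q^j)`. -/
def qShifted {R : Type*} [CommRing R] (a q : R) (n : ℕ) : R :=
  ∏ j ∈ Finset.range n, (1 - a * q ^ j)

/-- The polynomial `(q, q²; q³)_n = (q; q³)_n (q²; q³)_n` in `ℤ[q]`. -/
noncomputable def borweinProduct (n : ℕ) : ℤ[X] :=
  qShifted X (X ^ 3) n * qShifted (X ^ 2) (X ^ 3) n

/-- The Borwein polynomial `A_n`: its `k`-th coefficient is the coefficient of `q^(3k)` in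
`(q, q²; q³)_n`. -/
noncomputable def borweinA (n : ℕ) : ℤ[X] :=
  contract 3 (borweinProduct n)

/-- The Borwein polynomial `B_n`: its `k`-th coefficient is minus the coefficient of `q^(3k+1)` in
`(q, q²; q³)_n`. -/
noncomputable def borweinB (n : ℕ) : ℤ[X] :=
  -contract 3 (divX (borweinProduct n))

/-- The Borwein polynomial `C_n`: its `k`-th coefficient is minus the coefficient of `q^(3k+2)` in
`(q, q²; q³)_n`. -/
noncomputable def borweinC (n : ℕ) : ℤ[X] :=
  -contract 3 (divX (divX (borweinProduct n)))

/-- `A_n, B_n, C_n` are the unique polynomials with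
`A_n(q³) - q B_n(q³) - q² C_n(q³) = (q, q²; q³)_n`. -/
theorem borwein_iff (n : ℕ) (A B C : ℤ[X]) :
    expand ℤ 3 A - X * expand ℤ 3 B - X ^ 2 * expand ℤ 3 C = borweinProduct n ↔
      A = borweinA n ∧ B = borweinB n ∧ C = borweinC n := by
  have key : ∀ A B C : ℤ[X], ∀ k : ℕ,
      (expand ℤ 3 A - X * expand ℤ 3 B - X ^ 2 * expand ℤ 3 C).coeff (k * 3) = A.coeff k ∧
      (expand ℤ 3 A - X * expand ℤ 3 B - X ^ 2 * expand ℤ 3 C).coeff (k * 3 + 1) = -B.coeff k ∧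
      (expand ℤ 3 A - X * expand ℤ 3 B - X ^ 2 * expand ℤ 3 C).coeff (k * 3 + 2) = -C.coeff k := by
    intro A B C k
    have e1 : ¬ 3 ∣ k * 3 + 1 := by omega
    have e2 : ¬ 3 ∣ k * 3 + 2 := by omega
    refine ⟨?_, ?_, ?_⟩
    · rcases k with _ | k
      · simp [coeff_expand, pow_two, mul_assoc]
      · have e3 : (k + 1) * 3 = (k * 3 + 2) + 1 := by ring
        have e4 : (k + 1) * 3 = (k * 3 + 1) + 2 := by ring
        have h1 : (X * expand ℤ 3 B).coeff ((k + 1) * 3) = 0 := by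
          rw [e3, coeff_X_mul, coeff_expand (by norm_num), if_neg (by omega)]
        have h2 : (X ^ 2 * expand ℤ 3 C).coeff ((k + 1) * 3) = 0 := by
          rw [e4, coeff_X_pow_mul, coeff_expand (by norm_num), if_neg (by omega)]
        rw [coeff_sub, coeff_sub, h1, h2, coeff_expand_mul (by norm_num)]
        ring
    · have h2 : (X ^ 2 * expand ℤ 3 C).coeff (k * 3 + 1) = 0 := by
        rcases k with _ | k
        · simp [pow_two, mul_assoc, coeff_X_mul]
        · have e4 : (k + 1) * 3 + 1 = (k * 3 + 2) + 2 := by ring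
          rw [e4, coeff_X_pow_mul, coeff_expand (by norm_num), if_neg (by omega)]
      rw [coeff_sub, coeff_sub, h2, coeff_X_mul, coeff_expand_mul (by norm_num),
        coeff_expand (by norm_num), if_neg e1]
      ring
    · rw [coeff_sub, coeff_sub, coeff_X_mul, coeff_X_pow_mul, coeff_expand_mul (by norm_num),
        coeff_expand (by norm_num), if_neg e2, coeff_expand (by norm_num), if_neg e1]
      ring
  constructor
  · intro h
    refine ⟨?_, ?_, ?_⟩
    · ext k
      rw [borweinA, coeff_contract (by norm_num), ← h, (key A B C k).1]
    · ext k
      rw [borweinB, coeff_neg, coeff_contract (by norm_num), coeff_divX, ← h, (key A B C k).2.1,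
        neg_neg]
    · ext k
      rw [borweinC, coeff_neg, coeff_contract (by norm_num), coeff_divX, coeff_divX, ← h,
        add_assoc, (key A B C k).2.2, neg_neg]
  · rintro ⟨rfl, rfl, rfl⟩
    ext m
    obtain ⟨k, hk⟩ : ∃ k, m = k * 3 ∨ m = k * 3 + 1 ∨ m = k * 3 + 2 := ⟨m / 3, by omega⟩
    rcases hk with rfl | rfl | rfl
    · rw [(key _ _ _ k).1, borweinA, coeff_contract (by norm_num)]
    · rw [(key _ _ _ k).2.1, borweinB, coeff_neg, coeff_contract (by norm_num), coeff_divX,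
        neg_neg]
    · rw [(key _ _ _ k).2.2, borweinC, coeff_neg, coeff_contract (by norm_num), coeff_divX,
        coeff_divX, neg_neg]

/-- The indeterminate `q`, as an element of the field `ℚ(q)` of rational functions. -/
noncomputable def qVar : RatFunc ℚ := RatFunc.X

/-- `(q; q)_n` in `ℚ(q)`; it is nonzero for every `n`. -/
noncomputable def qFac (n : ℕ) : RatFunc ℚ := qShifted qVar qVar n

/-- `N₁ = n₁ + n₂ + n₃` for a triple `n = (n₁, n₂, n₃)`. -/
def bigN₁ (n : ℕ × ℕ × ℕ) : ℕ := n.1 + n.2.1 + n.2.2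

/-- `N₂ = n₂ + n₃`. -/
def bigN₂ (n : ℕ × ℕ × ℕ) : ℕ := n.2.1 + n.2.2

/-- `N₃ = n₃`. -/
def bigN₃ (n : ℕ × ℕ × ℕ) : ℕ := n.2.2

/-- The finite set of triples `(n₁, n₂, n₃)` of nonnegative integers with `N₁ + N₂ + N₃ < S`. -/
def triples (S : ℕ) : Finset (ℕ × ℕ × ℕ) :=
  {n ∈ Finset.range S ×ˢ Finset.range S ×ˢ Finset.range S | bigN₁ n + bigN₂ n + bigN₃ n < S}

theorem mem_triples {S : ℕ} {n : ℕ × ℕ × ℕ} :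
    n ∈ triples S ↔ bigN₁ n + bigN₂ n + bigN₃ n < S := by
  rw [triples, Finset.mem_filter, Finset.mem_product, Finset.mem_product, Finset.mem_range,
    Finset.mem_range, Finset.mem_range, bigN₁, bigN₂, bigN₃]
  omega

/-! Both sides equal the same alternating bilateral sum over k.

Product side: the q-binomial theorem in base q³ gives (q;q³)_L (q²;q³)_L = ∑_i (-1)^i q^{i(3i-1)/2}
[2L, L+i], the Gaussian binomials being in base q³ (`aeval_borweinProduct`). The exponent mod 3
depends only on i mod 3, so i = 3k yields A_L and i = -(3k+1) yields C_L as alternating sums of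
Gaussian binomials [2L, L+3k] and [2L, L+3k+1] (`aeval_borwein`).

Fermionic side: this is a Bailey-type argument. The factor 1/(q;q)_{N₃} is expanded over the kernels
1/((q;q)_{N₃-k} (q;q)_{N₃+k}), or with N₃+k+1 for C_L (`qi_eq_sum_even`, `qi_eq_sum_odd`). For fixed
k the sums over N₃, N₂, N₁ are then closed in turn by q-Chu–Vandermonde, q-Pfaff–Saalschütz and
q-Chu–Vandermonde again (`triple_sum_even`, `triple_sum_odd`). For C_L the middle sum misses being
balanced by one; pairing k with -1-k supplies a factor 1 - q^{2k+1} that turns it into a difference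
of two balanced sums.

Reciprocals of (q;q)_z vanish at negative z, so all sums run over fixed boxes and may be
interchanged freely. -/

/-! ### q-factorials at integer arguments, and telescoping. -/

section QFactorial

variable {K : Type*} [Field K]

/-- `(q; q)_z`, with value `1` for negative `z`. -/
def qf (q : K) (z : ℤ) : K := qShifted q q z.toNat

/-- `1 / (q; q)_z`, with the convention that it vanishes for negative `z`. -/
def qi (q : K) (z : ℤ) : K := if z < 0 then 0 else (qShifted q q z.toNat)⁻¹

theorem qi_of_neg (q : K) {z : ℤ} (hz : z < 0) : qi q z = 0 := if_pos hz

theorem qi_zero (q : K) : qi q 0 = 1 := by simp [qi, qShifted]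

theorem qi_eq_inv (q : K) {z : ℤ} (hz : 0 ≤ z) : qi q z = (qf q z)⁻¹ := if_neg (not_lt.2 hz)

theorem qf_eq_mul (q : K) {z : ℤ} (hz : 0 < z) : qf q z = (1 - q ^ z) * qf q (z - 1) := by
  obtain ⟨n, rfl⟩ : ∃ n : ℕ, z = n + 1 := ⟨(z - 1).toNat, by omega⟩
  have h1 : ((n : ℤ) + 1).toNat = n + 1 := by omega
  have h2 : ((n : ℤ) + 1 - 1).toNat = n := by omega
  rw [qf, qf, h1, h2, qShifted, Finset.prod_range_succ, qShifted, mul_comm]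
  congr 2
  rw [← pow_succ']
  exact_mod_cast rfl

/-- `q` is nonzero and not a root of unity. -/
structure Generic (q : K) : Prop where
  ne_zero : q ≠ 0
  pow_ne_one : ∀ n : ℕ, n ≠ 0 → q ^ n ≠ 1

variable {q : K}

/-- Used with exponent 3, since the product is expanded in base q³. -/
theorem Generic.pow (hq : Generic q) {m : ℕ} (hm : m ≠ 0) : Generic (q ^ m) where
  ne_zero := pow_ne_zero _ hq.ne_zero
  pow_ne_one n hn := by
    rw [← pow_mul]
    exact hq.pow_ne_one _ (mul_ne_zero hm hn)

theorem Generic.one_sub_zpow_ne_zero (hq : Generic q) {z : ℤ} (hz : 0 < z) : 1 - q ^ z ≠ 0 := by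
  obtain ⟨n, rfl⟩ : ∃ n : ℕ, z = n := ⟨z.toNat, by omega⟩
  rw [zpow_natCast]
  exact sub_ne_zero.2 (hq.pow_ne_one n (by omega)).symm

theorem Generic.qf_ne_zero (hq : Generic q) (z : ℤ) : qf q z ≠ 0 := by
  rw [qf, qShifted, Finset.prod_ne_zero_iff]
  intro j _
  rw [← pow_succ']
  exact sub_ne_zero.2 (hq.pow_ne_one _ (by omega)).symm

theorem Generic.qf_mul_qi (hq : Generic q) {z : ℤ} (hz : 0 ≤ z) : qf q z * qi q z = 1 := by
  rw [qi_eq_inv q hz, mul_inv_cancel₀ (hq.qf_ne_zero z)]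

/-- The vanishing convention makes this recurrence hold at every integer: at z = 0 the factor 1 -
q^0 kills the right side. Hence the telescoping checks need no boundary cases for `qi`, whereas
`qf_eq_mul` requires a positive argument. -/
theorem Generic.qi_sub_one (hq : Generic q) (z : ℤ) : qi q (z - 1) = (1 - q ^ z) * qi q z := by
  rcases lt_trichotomy z 0 with h | rfl | h
  · rw [qi_of_neg q h, qi_of_neg q (by omega), mul_zero]
  · rw [qi_of_neg q (by omega), zpow_zero, sub_self, zero_mul]
  · have h1 := hq.one_sub_zpow_ne_zero h
    rw [qi_eq_inv q h.le, qi_eq_inv q (by omega), qf_eq_mul q h, mul_inv, mul_inv_cancel_left₀ h1]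

/-- Moving a sum over a window `[k, k + m]` of a range to the origin. -/
theorem sum_range_sub_eq {f : ℤ → K} {m : ℤ} {k R : ℕ} (h0 : ∀ z < 0, f z = 0)
    (hm : ∀ z, m < z → f z = 0) (hR : m + k < R) :
    ∑ N ∈ Finset.range R, f (N - k) = ∑ j ∈ Finset.range (m + 1).toNat, f j := by
  have h1 : ∑ j ∈ Finset.range (m + 1).toNat, f j
      = ∑ N ∈ Finset.image (· + k) (Finset.range (m + 1).toNat), f ((N : ℤ) - k) := by
    rw [Finset.sum_image (by intro a _ b _ h; exact Nat.add_right_cancel h)]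
    exact Finset.sum_congr rfl fun j _ => by push_cast; rw [add_sub_cancel_right]
  rw [h1]
  symm
  refine Finset.sum_subset ?_ ?_
  · intro N hN
    simp only [Finset.mem_image, Finset.mem_range] at hN ⊢
    obtain ⟨j, hj, rfl⟩ := hN
    omega
  · intro N _ hN
    simp only [Finset.mem_image, Finset.mem_range, not_exists, not_and] at hN
    rcases lt_or_ge (N : ℤ) k with h | h
    · exact h0 _ (by omega)
    · refine hm _ ?_
      by_contra hlt
      exact hN (N - k) (by omega) (by omega)

/-- A summation formula proved by telescoping in the summation variable. -/
theorem telescope_sum_eq {t : ℕ → ℕ → K} {r : ℕ → K} {x y : ℕ → K} {G : ℕ → ℕ → K}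
    (hx : ∀ n, x (n + 1) ≠ 0) (h0 : t 0 0 = r 0) (ht : ∀ n, t n (n + 1) = 0)
    (hr : ∀ n, x (n + 1) * r (n + 1) = y (n + 1) * r n)
    (hG : ∀ n j, j ≤ n + 1 →
      x (n + 1) * t (n + 1) j - y (n + 1) * t n j = G (n + 1) j - G (n + 1) (j + 1))
    (hG0 : ∀ n, G (n + 1) 0 = 0) (hGn : ∀ n, G (n + 1) (n + 2) = 0) (n : ℕ) :
    ∑ j ∈ Finset.range (n + 1), t n j = r n := by
  induction n with
  | zero => simpa using h0
  | succ n ih =>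
    apply mul_left_cancel₀ (hx n)
    rw [hr, ← ih]
    have h1 : ∑ j ∈ Finset.range (n + 2), t n j = ∑ j ∈ Finset.range (n + 1), t n j := by
      rw [Finset.sum_range_succ, ht, add_zero]
    -- Summing `hG` over j collapses its right side to the two vanishing boundary values, so the
    -- sums obey the same first-order recurrence in n as `r`.
    have h2 : ∑ j ∈ Finset.range (n + 2), (x (n + 1) * t (n + 1) j - y (n + 1) * t n j) = 0 := by
      rw [Finset.sum_congr rfl fun j hj => hG n j (by rw [Finset.mem_range] at hj; omega),
        Finset.sum_range_sub', hG0, hGn, sub_zero]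
    rw [Finset.sum_sub_distrib, ← Finset.mul_sum, ← Finset.mul_sum, h1] at h2
    exact sub_eq_zero.1 h2

end QFactorial

/-! ### Terminating q-hypergeometric summations. -/

section Summation

variable {K : Type*} [Field K] {q : K}

/-- The terminating `q`-Chu–Vandermonde sum. -/
theorem sum_qVandermonde (hq : Generic q) (m : ℤ) {c : ℤ} (hc : 0 ≤ c) (n : ℕ) :
    ∑ j ∈ Finset.range (n + 1),
        q ^ ((j : ℤ) * (j + c)) * qi q j * qi q (j + c) * qi q (m - j) * qi q (n - j) =
      qf q (m + n + c) * qi q m * qi q n * qi q (m + c) * qi q (n + c) := by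
  rcases lt_or_ge m 0 with hm | hm
  · rw [qi_of_neg q hm, Finset.sum_eq_zero fun j _ => ?_]
    · simp
    · rw [qi_of_neg q (show m - j < 0 by omega)]
      simp
  -- The ratio y/x is that of consecutive right-hand sides. The certificate is G(n,j) = q^{n-j}
  -- (1-q^j) (1-q^{j+c}) t(n,j), with the two factors absorbed into `qi` at j-1 and j+c-1; it
  -- vanishes at j = 0 and j = n+1 by the convention on negative arguments. The next two sums use
  -- the same multiplier, and the q-binomial theorem uses it without the factor in c.
  refine telescope_sum_eq
    (t := fun n j =>
      q ^ ((j : ℤ) * (j + c)) * qi q j * qi q (j + c) * qi q (m - j) * qi q (n - j))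
    (r := fun n => qf q (m + n + c) * qi q m * qi q n * qi q (m + c) * qi q (n + c))
    (x := fun n => (1 - q ^ (n : ℤ)) * (1 - q ^ (n + c)))
    (y := fun n => 1 - q ^ (m + n + c))
    (G := fun n j => q ^ ((n : ℤ) - j + j * (j + c)) * qi q (j - 1) * qi q (j + c - 1) *
      qi q (m - j) * qi q (n - j)) ?_ ?_ ?_ ?_ ?_ ?_ ?_ n
  · intro n
    exact mul_ne_zero (hq.one_sub_zpow_ne_zero (by omega)) (hq.one_sub_zpow_ne_zero (by omega))
  · have h := hq.qf_mul_qi (show 0 ≤ m + c by omega)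
    simp only [Nat.cast_zero, zero_mul, zpow_zero, qi_zero, sub_zero, zero_add, add_zero]
    linear_combination (-qi q m * qi q c) * h
  · intro n
    simp only [qi_of_neg q (show (n : ℤ) - ((n + 1 : ℕ) : ℤ) < 0 by omega), mul_zero]
  · intro n
    have e1 := qf_eq_mul q (show 0 < m + ((n + 1 : ℕ) : ℤ) + c by omega)
    have e2 := hq.qi_sub_one ((n + 1 : ℕ) : ℤ)
    have e3 := hq.qi_sub_one (((n + 1 : ℕ) : ℤ) + c)
    rw [show m + ((n + 1 : ℕ) : ℤ) + c - 1 = m + n + c by push_cast; ring] at e1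
    rw [show ((n + 1 : ℕ) : ℤ) - 1 = n by push_cast; ring] at e2
    rw [show ((n + 1 : ℕ) : ℤ) + c - 1 = n + c by push_cast; ring] at e3
    rw [e1, e2, e3]
    ring
  · intro n j hj
    have hx : q ^ (j : ℤ) ≠ 0 := zpow_ne_zero _ hq.ne_zero
    have e1 := hq.qi_sub_one (j : ℤ)
    have e2 := hq.qi_sub_one ((j : ℤ) + c)
    have e3 := hq.qi_sub_one (m - j)
    have e4 := hq.qi_sub_one (((n + 1 : ℕ) : ℤ) - j)
    rw [show m - (j : ℤ) - 1 = m - ((j + 1 : ℕ) : ℤ) by push_cast; ring] at e3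
    rw [show (n : ℤ) - j = ((n + 1 : ℕ) : ℤ) - j - 1 by push_cast; ring,
      show ((n + 1 : ℕ) : ℤ) - ((j + 1 : ℕ) : ℤ) + ((j + 1 : ℕ) : ℤ) * (((j + 1 : ℕ) : ℤ) + c)
        = j * (j + c) + (n + 1 : ℕ) + j + c by push_cast; ring,
      show ((n + 1 : ℕ) : ℤ) - ((j + 1 : ℕ) : ℤ) = ((n + 1 : ℕ) : ℤ) - j - 1 by push_cast; ring,
      show (((j + 1 : ℕ) : ℤ)) - 1 = j by push_cast; ring,
      show (((j + 1 : ℕ) : ℤ)) + c - 1 = j + c by push_cast; ring, e1, e2, e3, e4]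
    simp only [zpow_add₀ hq.ne_zero, zpow_sub₀ hq.ne_zero]
    field_simp
    ring
  · intro n
    simp only [Nat.cast_zero, qi_of_neg q (show (0 : ℤ) - 1 < 0 by omega), mul_zero, zero_mul]
  · intro n
    simp only [qi_of_neg q (show ((n + 1 : ℕ) : ℤ) - ((n + 2 : ℕ) : ℤ) < 0 by omega), mul_zero]

/-- The limiting case of the `q`-Chu–Vandermonde sum in which one parameter tends to infinity. -/
theorem sum_qVandermonde_limit (hq : Generic q) {c : ℤ} (hc : 0 ≤ c) (n : ℕ) :
    ∑ j ∈ Finset.range (n + 1),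
        q ^ ((j : ℤ) * (j + c)) * qi q j * qi q (j + c) * qi q (n - j) =
      qi q n * qi q (n + c) := by
  refine telescope_sum_eq
    (t := fun n j => q ^ ((j : ℤ) * (j + c)) * qi q j * qi q (j + c) * qi q (n - j))
    (r := fun n => qi q n * qi q (n + c))
    (x := fun n => (1 - q ^ (n : ℤ)) * (1 - q ^ (n + c)))
    (y := fun n => 1)
    (G := fun n j => q ^ ((n : ℤ) - j + j * (j + c)) * qi q (j - 1) * qi q (j + c - 1) *
      qi q (n - j)) ?_ ?_ ?_ ?_ ?_ ?_ ?_ n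
  · intro n
    exact mul_ne_zero (hq.one_sub_zpow_ne_zero (by omega)) (hq.one_sub_zpow_ne_zero (by omega))
  · simp only [Nat.cast_zero, zero_mul, zpow_zero, qi_zero, sub_zero, zero_add, mul_one]
  · intro n
    simp only [qi_of_neg q (show (n : ℤ) - ((n + 1 : ℕ) : ℤ) < 0 by omega), mul_zero]
  · intro n
    have e2 := hq.qi_sub_one ((n + 1 : ℕ) : ℤ)
    have e3 := hq.qi_sub_one (((n + 1 : ℕ) : ℤ) + c)
    rw [show ((n + 1 : ℕ) : ℤ) - 1 = n by push_cast; ring] at e2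
    rw [show ((n + 1 : ℕ) : ℤ) + c - 1 = n + c by push_cast; ring] at e3
    rw [e2, e3]
    ring
  · intro n j hj
    have hx : q ^ (j : ℤ) ≠ 0 := zpow_ne_zero _ hq.ne_zero
    have e1 := hq.qi_sub_one (j : ℤ)
    have e2 := hq.qi_sub_one ((j : ℤ) + c)
    have e4 := hq.qi_sub_one (((n + 1 : ℕ) : ℤ) - j)
    rw [show (n : ℤ) - j = ((n + 1 : ℕ) : ℤ) - j - 1 by push_cast; ring,
      show ((n + 1 : ℕ) : ℤ) - ((j + 1 : ℕ) : ℤ) + ((j + 1 : ℕ) : ℤ) * (((j + 1 : ℕ) : ℤ) + c)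
        = j * (j + c) + (n + 1 : ℕ) + j + c by push_cast; ring,
      show ((n + 1 : ℕ) : ℤ) - ((j + 1 : ℕ) : ℤ) = ((n + 1 : ℕ) : ℤ) - j - 1 by push_cast; ring,
      show (((j + 1 : ℕ) : ℤ)) - 1 = j by push_cast; ring,
      show (((j + 1 : ℕ) : ℤ)) + c - 1 = j + c by push_cast; ring, e1, e2, e4]
    simp only [zpow_add₀ hq.ne_zero, zpow_sub₀ hq.ne_zero]
    field_simp
    ring
  · intro n
    simp only [Nat.cast_zero, qi_of_neg q (show (0 : ℤ) - 1 < 0 by omega), mul_zero, zero_mul]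
  · intro n
    simp only [qi_of_neg q (show ((n + 1 : ℕ) : ℤ) - ((n + 2 : ℕ) : ℤ) < 0 by omega), mul_zero]

/-- The `q`-Pfaff–Saalschütz sum. -/
theorem sum_qSaalschutz (hq : Generic q) (a b : ℤ) {c : ℤ} (hc : 0 ≤ c) (n : ℕ) :
    ∑ j ∈ Finset.range (n + 1),
        q ^ ((j : ℤ) * (j + c)) * qf q (n + a + b + c - j) * qi q j * qi q (j + c) *
          qi q (a - j) * qi q (b - j) * qi q (n - j) =
      qf q (n + a + c) * qf q (n + b + c) * qf q (a + b + c) *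
        qi q n * qi q a * qi q b * qi q (n + c) * qi q (a + c) * qi q (b + c) := by
  rcases lt_or_ge a 0 with ha | ha
  · rw [qi_of_neg q ha, Finset.sum_eq_zero fun j _ => ?_]
    · simp
    · rw [qi_of_neg q (show a - j < 0 by omega)]
      simp
  rcases lt_or_ge b 0 with hb | hb
  · rw [qi_of_neg q hb, Finset.sum_eq_zero fun j _ => ?_]
    · simp
    · rw [qi_of_neg q (show b - j < 0 by omega)]
      simp
  refine telescope_sum_eq
    (t := fun n j =>
      q ^ ((j : ℤ) * (j + c)) * qf q (n + a + b + c - j) * qi q j * qi q (j + c) *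
          qi q (a - j) * qi q (b - j) * qi q (n - j))
    (r := fun n => qf q (n + a + c) * qf q (n + b + c) * qf q (a + b + c) *
        qi q n * qi q a * qi q b * qi q (n + c) * qi q (a + c) * qi q (b + c))
    (x := fun n => (1 - q ^ (n : ℤ)) * (1 - q ^ (n + c)))
    (y := fun n => (1 - q ^ (n + a + c)) * (1 - q ^ (n + b + c)))
    (G := fun n j => q ^ ((n : ℤ) - j + j * (j + c)) * qf q (n + a + b + c - j) *
      qi q (j - 1) * qi q (j + c - 1) * qi q (a - j) * qi q (b - j) * qi q (n - j))
    ?_ ?_ ?_ ?_ ?_ ?_ ?_ n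
  · intro n
    exact mul_ne_zero (hq.one_sub_zpow_ne_zero (by omega)) (hq.one_sub_zpow_ne_zero (by omega))
  · have h1 := hq.qf_mul_qi (show 0 ≤ a + c by omega)
    have h2 := hq.qf_mul_qi (show 0 ≤ b + c by omega)
    simp only [Nat.cast_zero, zero_mul, zpow_zero, qi_zero, sub_zero, zero_add]
    linear_combination (-qf q (a + b + c) * qi q a * qi q b * qi q c) * h1 -
      (qf q (a + c) * qi q (a + c) * qf q (a + b + c) * qi q a * qi q b * qi q c) * h2
  · intro n
    simp only [qi_of_neg q (show (n : ℤ) - ((n + 1 : ℕ) : ℤ) < 0 by omega), mul_zero]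
  · intro n
    have e1 := qf_eq_mul q (show 0 < ((n + 1 : ℕ) : ℤ) + a + c by omega)
    have e4 := qf_eq_mul q (show 0 < ((n + 1 : ℕ) : ℤ) + b + c by omega)
    have e2 := hq.qi_sub_one ((n + 1 : ℕ) : ℤ)
    have e3 := hq.qi_sub_one (((n + 1 : ℕ) : ℤ) + c)
    rw [show ((n + 1 : ℕ) : ℤ) + a + c - 1 = n + a + c by push_cast; ring] at e1
    rw [show ((n + 1 : ℕ) : ℤ) + b + c - 1 = n + b + c by push_cast; ring] at e4
    rw [show ((n + 1 : ℕ) : ℤ) - 1 = n by push_cast; ring] at e2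
    rw [show ((n + 1 : ℕ) : ℤ) + c - 1 = n + c by push_cast; ring] at e3
    rw [e1, e2, e3, e4]
    ring
  · intro n j hj
    have hx : q ^ (j : ℤ) ≠ 0 := zpow_ne_zero _ hq.ne_zero
    have e1 := hq.qi_sub_one (j : ℤ)
    have e2 := hq.qi_sub_one ((j : ℤ) + c)
    have e3 := hq.qi_sub_one (a - j)
    have e5 := hq.qi_sub_one (b - j)
    have e4 := hq.qi_sub_one (((n + 1 : ℕ) : ℤ) - j)
    -- The recurrence for `qf` fails at non-positive arguments. There b, c ≥ 0 and j ≤ n+1 force a -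
    -- j < 0, so the factor `qi q (a - j)` makes both sides zero.
    have e6 : qf q (((n + 1 : ℕ) : ℤ) + a + b + c - j) * qi q (a - j) =
        (1 - q ^ (((n + 1 : ℕ) : ℤ) + a + b + c - j)) * qf q (n + a + b + c - j) *
          qi q (a - j) := by
      rcases lt_or_ge 0 (((n + 1 : ℕ) : ℤ) + a + b + c - j) with h | h
      · rw [qf_eq_mul q h, show ((n + 1 : ℕ) : ℤ) + a + b + c - j - 1 = n + a + b + c - j by
          push_cast; ring]
      · rw [qi_of_neg q (show a - j < 0 by omega), mul_zero, mul_zero]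
    rw [show a - (j : ℤ) - 1 = a - ((j + 1 : ℕ) : ℤ) by push_cast; ring] at e3
    rw [show b - (j : ℤ) - 1 = b - ((j + 1 : ℕ) : ℤ) by push_cast; ring] at e5
    rw [show (n : ℤ) - j = ((n + 1 : ℕ) : ℤ) - j - 1 by push_cast; ring,
      show ((n + 1 : ℕ) : ℤ) - ((j + 1 : ℕ) : ℤ) + ((j + 1 : ℕ) : ℤ) * (((j + 1 : ℕ) : ℤ) + c)
        = j * (j + c) + (n + 1 : ℕ) + j + c by push_cast; ring,
      show ((n + 1 : ℕ) : ℤ) + a + b + c - ((j + 1 : ℕ) : ℤ) = n + a + b + c - j by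
        push_cast; ring,
      show ((n + 1 : ℕ) : ℤ) - ((j + 1 : ℕ) : ℤ) = ((n + 1 : ℕ) : ℤ) - j - 1 by push_cast; ring,
      show (((j + 1 : ℕ) : ℤ)) - 1 = j by push_cast; ring,
      show (((j + 1 : ℕ) : ℤ)) + c - 1 = j + c by push_cast; ring, e1, e2, e3, e4, e5]
    have e7 : ∀ u v w : K, u * qf q (((n + 1 : ℕ) : ℤ) + a + b + c - j) * v * w * qi q (a - j) =
        u * ((1 - q ^ (((n + 1 : ℕ) : ℤ) + a + b + c - j)) * qf q (n + a + b + c - j)) * v * w *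
          qi q (a - j) := fun u v w => by linear_combination (u * v * w) * e6
    rw [e7, e7]
    generalize qf q (n + a + b + c - j) = f
    simp only [zpow_add₀ hq.ne_zero, zpow_sub₀ hq.ne_zero]
    field_simp
    ring
  · intro n
    simp only [Nat.cast_zero, qi_of_neg q (show (0 : ℤ) - 1 < 0 by omega), mul_zero, zero_mul]
  · intro n
    simp only [qi_of_neg q (show ((n + 1 : ℕ) : ℤ) - ((n + 2 : ℕ) : ℤ) < 0 by omega), mul_zero]

/-- The `q`-binomial theorem, divided by `(q; q)_n`. -/
theorem sum_qBinomial (hq : Generic q) (z : K) (n : ℕ) :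
    ∑ j ∈ Finset.range (n + 1), (-1) ^ j * q ^ (j.choose 2) * z ^ j * qi q j * qi q (n - j) =
      qShifted z q n * qi q n := by
  refine telescope_sum_eq
    (t := fun n j => (-1) ^ j * q ^ (j.choose 2) * z ^ j * qi q j * qi q (n - j))
    (r := fun n => qShifted z q n * qi q n)
    (x := fun n => 1 - q ^ (n : ℤ))
    (y := fun n => 1 - z * q ^ ((n : ℤ) - 1))
    (G := fun n j => (-1) ^ j * q ^ (j.choose 2) * q ^ ((n : ℤ) - j) * z ^ j *
      qi q (j - 1) * qi q (n - j)) ?_ ?_ ?_ ?_ ?_ ?_ ?_ n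
  · intro n
    exact hq.one_sub_zpow_ne_zero (by omega)
  · simp [qi_zero, qShifted]
  · intro n
    simp only [qi_of_neg q (show (n : ℤ) - ((n + 1 : ℕ) : ℤ) < 0 by omega), mul_zero]
  · intro n
    have e2 := hq.qi_sub_one ((n + 1 : ℕ) : ℤ)
    rw [show ((n + 1 : ℕ) : ℤ) - 1 = n by push_cast; ring] at e2 ⊢
    rw [e2, qShifted, Finset.prod_range_succ, qShifted, zpow_natCast q n]
    ring
  · intro n j hj
    have hx : q ^ (j : ℤ) ≠ 0 := zpow_ne_zero _ hq.ne_zero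
    have e1 := hq.qi_sub_one (j : ℤ)
    have e4 := hq.qi_sub_one (((n + 1 : ℕ) : ℤ) - j)
    rw [show (n : ℤ) - j = ((n + 1 : ℕ) : ℤ) - j - 1 by push_cast; ring,
      show ((n + 1 : ℕ) : ℤ) - ((j + 1 : ℕ) : ℤ) = ((n + 1 : ℕ) : ℤ) - j - 1 by push_cast; ring,
      show (((j + 1 : ℕ) : ℤ)) - 1 = j by push_cast; ring, e1, e4,
      Nat.choose_succ_succ' j 1, Nat.choose_one_right, pow_add q, ← zpow_natCast q j]
    simp only [zpow_sub₀ hq.ne_zero, zpow_one]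
    have hq0 := hq.ne_zero
    field_simp
    ring
  · intro n
    simp only [Nat.cast_zero, qi_of_neg q (show (0 : ℤ) - 1 < 0 by omega), mul_zero, zero_mul]
  · intro n
    simp only [qi_of_neg q (show ((n + 1 : ℕ) : ℤ) - ((n + 2 : ℕ) : ℤ) < 0 by omega), mul_zero]

end Summation

/-! ### Evaluation of the threefold sums against a fixed kernel. -/

section Nested

variable {K : Type*} [Field K] {q : K}

/-- Terms outside k ≤ N ≤ k + n vanish, so N may run over a range that does not depend on k. For
negative n the window is empty and `qi q n` kills the right side. -/
theorem sum_qVandermonde_window (hq : Generic q) (m n : ℤ) {c : ℤ} (hc : 0 ≤ c) {k R : ℕ}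
    (hR : n + k < R) :
    ∑ N ∈ Finset.range R,
        q ^ (((N : ℤ) - k) * (N - k + c)) * qi q (N - k) * qi q (N - k + c) *
          qi q (m - (N - k)) * qi q (n - (N - k)) =
      qf q (m + n + c) * qi q m * qi q n * qi q (m + c) * qi q (n + c) := by
  rw [sum_range_sub_eq (m := n)
    (f := fun z => q ^ (z * (z + c)) * qi q z * qi q (z + c) * qi q (m - z) * qi q (n - z))
    (fun z hz => by simp [qi_of_neg q hz])
    (fun z hz => by simp [qi_of_neg q (show n - z < 0 by omega)]) hR]
  rcases lt_or_ge n 0 with hn | hn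
  · simp [qi_of_neg q hn, show (n + 1).toNat = 0 by omega]
  · lift n to ℕ using hn
    exact sum_qVandermonde hq m hc n

theorem sum_qVandermonde_limit_window (hq : Generic q) (n : ℤ) {c : ℤ} (hc : 0 ≤ c) {k R : ℕ}
    (hR : n + k < R) :
    ∑ N ∈ Finset.range R,
        q ^ (((N : ℤ) - k) * (N - k + c)) * qi q (N - k) * qi q (N - k + c) *
          qi q (n - (N - k)) = qi q n * qi q (n + c) := by
  rw [sum_range_sub_eq (m := n)
    (f := fun z => q ^ (z * (z + c)) * qi q z * qi q (z + c) * qi q (n - z))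
    (fun z hz => by simp [qi_of_neg q hz])
    (fun z hz => by simp [qi_of_neg q (show n - z < 0 by omega)]) hR]
  rcases lt_or_ge n 0 with hn | hn
  · simp [qi_of_neg q hn, show (n + 1).toNat = 0 by omega]
  · lift n to ℕ using hn
    exact sum_qVandermonde_limit hq hc n

theorem sum_qSaalschutz_window (hq : Generic q) (a b n : ℤ) {c : ℤ} (hc : 0 ≤ c) {k R : ℕ}
    (hR : n + k < R) :
    ∑ N ∈ Finset.range R,
        q ^ (((N : ℤ) - k) * (N - k + c)) * qf q (n + a + b + c - (N - k)) * qi q (N - k) *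
          qi q (N - k + c) * qi q (a - (N - k)) * qi q (b - (N - k)) * qi q (n - (N - k)) =
      qf q (n + a + c) * qf q (n + b + c) * qf q (a + b + c) *
        qi q n * qi q a * qi q b * qi q (n + c) * qi q (a + c) * qi q (b + c) := by
  rw [sum_range_sub_eq (m := n)
    (f := fun z => q ^ (z * (z + c)) * qf q (n + a + b + c - z) * qi q z *
          qi q (z + c) * qi q (a - z) * qi q (b - z) * qi q (n - z))
    (fun z hz => by simp [qi_of_neg q hz])
    (fun z hz => by simp [qi_of_neg q (show n - z < 0 by omega)]) hR]
  rcases lt_or_ge n 0 with hn | hn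
  · simp [qi_of_neg q hn, show (n + 1).toNat = 0 by omega]
  · lift n to ℕ using hn
    exact sum_qSaalschutz hq a b hc n

/-- A nearly balanced companion of the `q`-Pfaff–Saalschütz sum. -/
theorem sum_qSaalschutz_companion (hq : Generic q) (a b n : ℤ) {c : ℤ} (hc : 0 ≤ c) {k R : ℕ}
    (hR : n + k < R) :
    (1 - q ^ (a - b)) * ∑ N ∈ Finset.range R,
        q ^ (((N : ℤ) - k) * (N - k + c)) * qf q (n + a + b + c - 1 - (N - k)) * qi q (N - k) *
          qi q (N - k + c) * qi q (a - (N - k)) * qi q (b - (N - k)) * qi q (n - (N - k)) =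
      qf q (a + b + c - 1) * qi q n * qi q (n + c) *
        (qf q (n + a + c - 1) * qf q (n + b + c) * qi q (a - 1) * qi q b *
            qi q (a + c - 1) * qi q (b + c) -
          q ^ (a - b) * (qf q (n + a + c) * qf q (n + b + c - 1) * qi q a * qi q (b - 1) *
            qi q (a + c) * qi q (b + c - 1))) := by
  -- Lowering a or b by one gives two balanced sums. Their summands combine to the present one
  -- because (1 - q^{a-j}) - q^{a-b} (1 - q^{b-j}) = 1 - q^{a-b}.
  have h1 := sum_qSaalschutz_window hq (a - 1) b n hc hR
  have h2 := sum_qSaalschutz_window hq a (b - 1) n hc hR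
  rw [show n + (a - 1) + c = n + a + c - 1 by ring, show a - 1 + b + c = a + b + c - 1 by ring,
    show a - 1 + c = a + c - 1 by ring] at h1
  rw [show n + (b - 1) + c = n + b + c - 1 by ring, show a + (b - 1) + c = a + b + c - 1 by ring,
    show b - 1 + c = b + c - 1 by ring] at h2
  rw [show ∀ x A B C D E F G H I J : K, x * A * B * (C * D * E * F * G * H - I * (J)) =
    C * D * x * E * F * A * B * G * H - I * (x * A * B * J) from fun _ _ _ _ _ _ _ _ _ _ _ => by
      ring]
  have h3 : ∀ x A B I C D E F G H : K, I * (x * A * B * (C * D * E * F * G * H)) =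
    I * (C * D * x * A * E * F * B * G * H) := fun _ _ _ _ _ _ _ _ _ _ => by ring
  rw [h3]
  have h4 : ∀ x A B C D E F G H : K,
    C * D * x * E * F * A * B * G * H = C * D * x * A * E * F * B * G * H :=
      fun _ _ _ _ _ _ _ _ _ => by ring
  rw [h4, ← h1, ← h2, Finset.mul_sum, Finset.mul_sum, ← Finset.sum_sub_distrib]
  refine Finset.sum_congr rfl fun N _ => ?_
  have e1 := hq.qi_sub_one (a - (N - k))
  have e2 := hq.qi_sub_one (b - (N - k))
  have e3 : q ^ (a - b) * q ^ (b - (N - k)) = q ^ (a - (N - k)) := by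
    rw [← zpow_add₀ hq.ne_zero]
    congr 1
    ring
  rw [show a - 1 - ((N : ℤ) - k) = a - (N - k) - 1 by ring,
    show b - 1 - ((N : ℤ) - k) = b - (N - k) - 1 by ring,
    show n + (a - 1) + b + c - ((N : ℤ) - k) = n + a + b + c - 1 - (N - k) by ring,
    show n + a + (b - 1) + c - ((N : ℤ) - k) = n + a + b + c - 1 - (N - k) by ring, e1, e2, ← e3]
  ring

/-- The threefold sum, against the kernel `1 / ((q; q)_{N - k} (q; q)_{N + k})`. -/
theorem triple_sum_even (hq : Generic q) (L k : ℕ) :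
    ∑ N₁ ∈ Finset.range (L + 1), ∑ N₂ ∈ Finset.range (L + 1), ∑ N₃ ∈ Finset.range (L + 1),
        q ^ ((N₁ : ℤ) ^ 2 + N₂ ^ 2 + N₃ ^ 2) * qf q (L - N₁) * qf q (2 * L - N₁ - N₂) *
          qi q (2 * L - 2 * N₁) * qi q (L - N₁ - N₂ - N₃) * qi q (N₁ - N₂) * qi q (N₂ - N₃) *
            (qi q (N₃ - k) * qi q (N₃ + k)) =
      q ^ (3 * (k : ℤ) ^ 2) * qf q (2 * L) * qi q (L - 3 * k) * qi q (L + 3 * k) := by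
  have inner : ∀ N₁ ∈ Finset.range (L + 1), ∀ N₂ ∈ Finset.range (L + 1),
      ∑ N₃ ∈ Finset.range (L + 1),
        q ^ ((N₁ : ℤ) ^ 2 + N₂ ^ 2 + N₃ ^ 2) * qf q (L - N₁) * qf q (2 * L - N₁ - N₂) *
          qi q (2 * L - 2 * N₁) * qi q (L - N₁ - N₂ - N₃) * qi q (N₁ - N₂) * qi q (N₂ - N₃) *
            (qi q (N₃ - k) * qi q (N₃ + k)) =
      q ^ ((N₁ : ℤ) ^ 2 + N₂ ^ 2 + k ^ 2) * qf q (L - N₁) * qf q (2 * L - N₁ - N₂) *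
          qi q (2 * L - 2 * N₁) * qi q (N₁ - N₂) * (qf q (L - N₁) * qi q (L - N₁ - N₂ - k) *
            qi q (N₂ - k) * qi q (L - N₁ - N₂ + k) * qi q (N₂ + k)) := by
    intro N₁ h₁ N₂ h₂
    rw [Finset.mem_range] at h₁ h₂
    -- With c = 2k, the exponent N₃² = k² + (N₃-k)(N₃+k) has the required shape; the same splitting
    -- serves for N₂ and N₁.
    have h := sum_qVandermonde_window hq (L - N₁ - N₂ - k) (N₂ - k) (c := 2 * k) (k := k)
      (R := L + 1) (by omega) (by push_cast; omega)
    rw [show (L : ℤ) - N₁ - N₂ - k + (N₂ - k) + 2 * k = L - N₁ by ring,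
      show (L : ℤ) - N₁ - N₂ - k + 2 * k = L - N₁ - N₂ + k by ring,
      show (N₂ : ℤ) - k + 2 * k = N₂ + k by ring] at h
    rw [← h, Finset.mul_sum]
    refine Finset.sum_congr rfl fun N₃ _ => ?_
    rw [show (N₃ : ℤ) - k + 2 * k = N₃ + k by ring,
      show (L : ℤ) - N₁ - N₂ - k - (N₃ - k) = L - N₁ - N₂ - N₃ by ring,
      show (N₂ : ℤ) - k - (N₃ - k) = N₂ - N₃ by ring,
      show (N₁ : ℤ) ^ 2 + N₂ ^ 2 + N₃ ^ 2 = N₁ ^ 2 + N₂ ^ 2 + k ^ 2 + (N₃ - k) * (N₃ + k) by ring,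
      zpow_add₀ hq.ne_zero _ (((N₃ : ℤ) - k) * (N₃ + k))]
    ring
  have middle : ∀ N₁ ∈ Finset.range (L + 1), ∑ N₂ ∈ Finset.range (L + 1),
      q ^ ((N₁ : ℤ) ^ 2 + N₂ ^ 2 + k ^ 2) * qf q (L - N₁) * qf q (2 * L - N₁ - N₂) *
          qi q (2 * L - 2 * N₁) * qi q (N₁ - N₂) * (qf q (L - N₁) * qi q (L - N₁ - N₂ - k) *
            qi q (N₂ - k) * qi q (L - N₁ - N₂ + k) * qi q (N₂ + k)) =
      q ^ ((N₁ : ℤ) ^ 2 + 2 * k ^ 2) * (qf q (L + k) * qf q (L - k) *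
        qi q (N₁ - k) * qi q (N₁ + k) * qi q (L - N₁ - 2 * k) * qi q (L - N₁ + 2 * k)) := by
    intro N₁ h₁
    rw [Finset.mem_range] at h₁
    -- These parameters make (q;q)_{2L-N₁-N₂} the balancing factor, and the resulting (q;q)_{2L-2N₁}
    -- cancels the denominator of the summand.
    have h := sum_qSaalschutz_window hq (L - N₁) (L - N₁ - 2 * k) (N₁ - k) (c := 2 * k) (k := k)
      (R := L + 1) (by omega) (by push_cast; omega)
    rw [show (N₁ : ℤ) - k + (L - N₁) + 2 * k = L + k by ring,
      show (N₁ : ℤ) - k + (L - N₁ - 2 * k) + 2 * k = L - k by ring,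
      show (L : ℤ) - N₁ + (L - N₁ - 2 * k) + 2 * k = 2 * L - 2 * N₁ by ring,
      show (N₁ : ℤ) - k + 2 * k = N₁ + k by ring,
      show (L : ℤ) - N₁ - 2 * k + 2 * k = L - N₁ by ring] at h
    have h3 := hq.qf_mul_qi (show 0 ≤ (L : ℤ) - N₁ by omega)
    have h4 := hq.qf_mul_qi (show 0 ≤ 2 * (L : ℤ) - 2 * N₁ by omega)
    trans q ^ ((N₁ : ℤ) ^ 2 + 2 * k ^ 2) * (qf q (L - N₁) * qf q (L - N₁) *
      qi q (2 * L - 2 * N₁)) * (qf q (L + k) * qf q (L - k) * qf q (2 * L - 2 * N₁) *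
        qi q (N₁ - k) * qi q (L - N₁) * qi q (L - N₁ - 2 * k) * qi q (N₁ + k) *
        qi q (L - N₁ + 2 * k) * qi q (L - N₁))
    · rw [← h, Finset.mul_sum]
      refine Finset.sum_congr rfl fun N₂ _ => ?_
      rw [show (N₂ : ℤ) - k + 2 * k = N₂ + k by ring,
        show (N₁ : ℤ) - k + (L - N₁) + (L - N₁ - 2 * k) + 2 * k - (N₂ - k) = 2 * L - N₁ - N₂ by
          ring,
        show (L : ℤ) - N₁ - (N₂ - k) = L - N₁ - N₂ + k by ring,
        show (L : ℤ) - N₁ - 2 * k - (N₂ - k) = L - N₁ - N₂ - k by ring,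
        show (N₁ : ℤ) - k - (N₂ - k) = N₁ - N₂ by ring,
        show (N₁ : ℤ) ^ 2 + N₂ ^ 2 + k ^ 2 = N₁ ^ 2 + 2 * k ^ 2 + (N₂ - k) * (N₂ + k) by ring,
        zpow_add₀ hq.ne_zero _ (((N₂ : ℤ) - k) * (N₂ + k))]
      ring
    · have e1 : ∀ x f f' g g' A B C D E F : K,
          x * (f * f * g') * (A * B * f' * C * g * D * E * F * g) =
            (f * g) * (f * g) * (f' * g') * (x * (A * B * C * E * D * F)) :=
        fun _ _ _ _ _ _ _ _ _ _ _ => by ring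
      rw [e1, h3, h4, one_mul, one_mul, one_mul]
  rw [Finset.sum_congr rfl fun N₁ h₁ =>
    (Finset.sum_congr rfl fun N₂ h₂ => inner N₁ h₁ N₂ h₂).trans (middle N₁ h₁)]
  -- Cancelling (q;q)_{L-k} below needs k ≤ L; otherwise both sides vanish.
  rcases lt_or_ge (L : ℤ) k with hk | hk
  · rw [qi_of_neg q (show (L : ℤ) - 3 * k < 0 by omega), mul_zero, zero_mul]
    refine Finset.sum_eq_zero fun N₁ _ => ?_
    rw [qi_of_neg q (show (L : ℤ) - N₁ - 2 * k < 0 by omega)]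
    simp
  have h := sum_qVandermonde_window hq (L + k) (L - 3 * k) (c := 2 * k) (k := k)
    (R := L + 1) (by omega) (by push_cast; omega)
  rw [show (L : ℤ) + k + (L - 3 * k) + 2 * k = 2 * L by ring,
    show (L : ℤ) + k + 2 * k = L + 3 * k by ring,
    show (L : ℤ) - 3 * k + 2 * k = L - k by ring] at h
  have h3 := hq.qf_mul_qi (show 0 ≤ (L : ℤ) + k by omega)
  have h4 := hq.qf_mul_qi (show 0 ≤ (L : ℤ) - k by omega)
  trans q ^ (3 * (k : ℤ) ^ 2) * (qf q (L + k) * qf q (L - k)) * (qf q (2 * L) * qi q (L + k) *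
    qi q (L - 3 * k) * qi q (L + 3 * k) * qi q (L - k))
  · rw [← h, Finset.mul_sum]
    refine Finset.sum_congr rfl fun N₁ _ => ?_
    rw [show (N₁ : ℤ) - k + 2 * k = N₁ + k by ring,
      show (L : ℤ) + k - (N₁ - k) = L - N₁ + 2 * k by ring,
      show (L : ℤ) - 3 * k - (N₁ - k) = L - N₁ - 2 * k by ring,
      show (N₁ : ℤ) ^ 2 + 2 * k ^ 2 = 3 * k ^ 2 + (N₁ - k) * (N₁ + k) by ring,
      zpow_add₀ hq.ne_zero _ (((N₁ : ℤ) - k) * (N₁ + k))]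
    ring
  · have e1 : ∀ x f f' g g' A B C : K, x * (f * f') * (A * g * B * C * g') =
        (f * g) * (f' * g') * (x * A * B * C) := fun _ _ _ _ _ _ _ _ => by ring
    rw [e1, h3, h4, one_mul, one_mul]

/-- The threefold sum, against the kernel `1 / ((q; q)_{N - k} (q; q)_{N + k + 1})`. -/
theorem triple_sum_odd (hq : Generic q) (L k : ℕ) :
    (1 - q ^ (2 * (k : ℤ) + 1)) *
      ∑ N₁ ∈ Finset.range L, ∑ N₂ ∈ Finset.range L, ∑ N₃ ∈ Finset.range L,
        q ^ ((N₁ : ℤ) ^ 2 + N₂ ^ 2 + N₃ ^ 2 + N₁ + N₂ + N₃) * qf q (L - N₁ - 1) *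
          qf q (2 * L - N₁ - N₂ - 1) * qi q (2 * L - 2 * N₁ - 1) *
          qi q (L - N₁ - N₂ - N₃ - 1) * qi q (N₁ - N₂) * qi q (N₂ - N₃) *
            (qi q (N₃ - k) * qi q (N₃ + k + 1)) =
      q ^ (3 * (k : ℤ) ^ 2 + 3 * k) * qf q (2 * L) *
        (qi q (L - 3 * k - 1) * qi q (L + 3 * k + 1) -
          q ^ (2 * (k : ℤ) + 1) * (qi q (L - 3 * k - 2) * qi q (L + 3 * k + 2))) := by
  have inner : ∀ N₁ ∈ Finset.range L, ∀ N₂ ∈ Finset.range L,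
      ∑ N₃ ∈ Finset.range L,
        q ^ ((N₁ : ℤ) ^ 2 + N₂ ^ 2 + N₃ ^ 2 + N₁ + N₂ + N₃) * qf q (L - N₁ - 1) *
          qf q (2 * L - N₁ - N₂ - 1) * qi q (2 * L - 2 * N₁ - 1) *
          qi q (L - N₁ - N₂ - N₃ - 1) * qi q (N₁ - N₂) * qi q (N₂ - N₃) *
            (qi q (N₃ - k) * qi q (N₃ + k + 1)) =
      q ^ ((N₁ : ℤ) ^ 2 + N₂ ^ 2 + k ^ 2 + N₁ + N₂ + k) * qf q (L - N₁ - 1) *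
          qf q (2 * L - N₁ - N₂ - 1) * qi q (2 * L - 2 * N₁ - 1) * qi q (N₁ - N₂) *
            (qf q (L - N₁) * qi q (L - N₁ - N₂ - k - 1) * qi q (N₂ - k) *
              qi q (L - N₁ - N₂ + k) * qi q (N₂ + k + 1)) := by
    intro N₁ h₁ N₂ h₂
    rw [Finset.mem_range] at h₁ h₂
    have h := sum_qVandermonde_window hq (L - N₁ - N₂ - k - 1) (N₂ - k) (c := 2 * k + 1) (k := k)
      (R := L) (by omega) (by omega)
    rw [show (L : ℤ) - N₁ - N₂ - k - 1 + (N₂ - k) + (2 * k + 1) = L - N₁ by ring,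
      show (L : ℤ) - N₁ - N₂ - k - 1 + (2 * k + 1) = L - N₁ - N₂ + k by ring,
      show (N₂ : ℤ) - k + (2 * k + 1) = N₂ + k + 1 by ring] at h
    rw [← h, Finset.mul_sum]
    refine Finset.sum_congr rfl fun N₃ _ => ?_
    rw [show (N₃ : ℤ) - k + (2 * k + 1) = N₃ + k + 1 by ring,
      show (L : ℤ) - N₁ - N₂ - k - 1 - (N₃ - k) = L - N₁ - N₂ - N₃ - 1 by ring,
      show (N₂ : ℤ) - k - (N₃ - k) = N₂ - N₃ by ring,
      show (N₁ : ℤ) ^ 2 + N₂ ^ 2 + N₃ ^ 2 + N₁ + N₂ + N₃ =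
        N₁ ^ 2 + N₂ ^ 2 + k ^ 2 + N₁ + N₂ + k + (N₃ - k) * (N₃ + k + 1) by ring,
      zpow_add₀ hq.ne_zero _ (((N₃ : ℤ) - k) * (N₃ + k + 1))]
    ring
  have middle : ∀ N₁ ∈ Finset.range L, (1 - q ^ (2 * (k : ℤ) + 1)) * ∑ N₂ ∈ Finset.range L,
      q ^ ((N₁ : ℤ) ^ 2 + N₂ ^ 2 + k ^ 2 + N₁ + N₂ + k) * qf q (L - N₁ - 1) *
          qf q (2 * L - N₁ - N₂ - 1) * qi q (2 * L - 2 * N₁ - 1) * qi q (N₁ - N₂) *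
            (qf q (L - N₁) * qi q (L - N₁ - N₂ - k - 1) * qi q (N₂ - k) *
              qi q (L - N₁ - N₂ + k) * qi q (N₂ + k + 1)) =
      q ^ ((N₁ : ℤ) ^ 2 + N₁ + 2 * (k ^ 2 + k)) * qi q (N₁ - k) * qi q (N₁ + k + 1) *
        (qf q (L + k) * qf q (L - k) * qi q (L - N₁ - 2 * k - 1) * qi q (L - N₁ + 2 * k) -
          q ^ (2 * (k : ℤ) + 1) * (qf q (L + k + 1) * qf q (L - k - 1) *
            qi q (L - N₁ - 2 * k - 2) * qi q (L - N₁ + 2 * k + 1))) := by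
    intro N₁ h₁
    rw [Finset.mem_range] at h₁
    -- The balancing factor would be (q;q)_{2L-N₁-N₂}, but the summand carries index one less. Here
    -- a - b = 2k+1, which is the exponent in the prefactor.
    have h := sum_qSaalschutz_companion hq (L - N₁) (L - N₁ - 2 * k - 1) (N₁ - k)
      (c := 2 * k + 1) (k := k) (R := L) (by omega) (by omega)
    rw [show (L : ℤ) - N₁ - (L - N₁ - 2 * k - 1) = 2 * k + 1 by ring,
      show (L : ℤ) - N₁ + (L - N₁ - 2 * k - 1) + (2 * k + 1) - 1 = 2 * L - 2 * N₁ - 1 by ring,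
      show (N₁ : ℤ) - k + (2 * k + 1) = N₁ + k + 1 by ring,
      show (N₁ : ℤ) - k + (L - N₁) + (2 * k + 1) = L + k + 1 by ring,
      show (N₁ : ℤ) - k + (L - N₁ - 2 * k - 1) + (2 * k + 1) = L - k by ring,
      show (L : ℤ) - N₁ - 2 * k - 1 + (2 * k + 1) = L - N₁ by ring,
      show (L : ℤ) - N₁ + (2 * k + 1) = L - N₁ + 2 * k + 1 by ring,
      show (L : ℤ) - N₁ - 2 * k - 1 - 1 = L - N₁ - 2 * k - 2 by ring,
      add_sub_cancel_right, add_sub_cancel_right] at h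
    have h3 := hq.qf_mul_qi (show 0 ≤ (L : ℤ) - N₁ by omega)
    have h5 := hq.qf_mul_qi (show 0 ≤ (L : ℤ) - N₁ - 1 by omega)
    have h4 := hq.qf_mul_qi (show 0 ≤ 2 * (L : ℤ) - 2 * N₁ - 1 by omega)
    trans q ^ ((N₁ : ℤ) ^ 2 + N₁ + 2 * (k ^ 2 + k)) * (qf q (L - N₁) * qf q (L - N₁ - 1) *
      qi q (2 * L - 2 * N₁ - 1)) * (qf q (2 * L - 2 * N₁ - 1) * qi q (N₁ - k) *
        qi q (N₁ + k + 1) * (qf q (L + k) * qf q (L - k) * qi q (L - N₁ - 1) *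
          qi q (L - N₁ - 2 * k - 1) * qi q (L - N₁ + 2 * k) * qi q (L - N₁) -
          q ^ (2 * (k : ℤ) + 1) * (qf q (L + k + 1) * qf q (L - k - 1) * qi q (L - N₁) *
            qi q (L - N₁ - 2 * k - 2) * qi q (L - N₁ + 2 * k + 1) * qi q (L - N₁ - 1))))
    · rw [← h, mul_left_comm _ (1 - q ^ (2 * (k : ℤ) + 1))]
      congr 1
      rw [Finset.mul_sum]
      refine Finset.sum_congr rfl fun N₂ _ => ?_
      rw [show (N₂ : ℤ) - k + (2 * k + 1) = N₂ + k + 1 by ring,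
        show (N₁ : ℤ) - k + (L - N₁) + (L - N₁ - 2 * k - 1) + (2 * k + 1) - 1 - (N₂ - k) =
          2 * L - N₁ - N₂ - 1 by ring,
        show (L : ℤ) - N₁ - (N₂ - k) = L - N₁ - N₂ + k by ring,
        show (L : ℤ) - N₁ - 2 * k - 1 - (N₂ - k) = L - N₁ - N₂ - k - 1 by ring,
        show (N₁ : ℤ) - k - (N₂ - k) = N₁ - N₂ by ring,
        show (N₁ : ℤ) ^ 2 + N₂ ^ 2 + k ^ 2 + N₁ + N₂ + k =
          N₁ ^ 2 + N₁ + 2 * (k ^ 2 + k) + (N₂ - k) * (N₂ + k + 1) by ring,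
        zpow_add₀ hq.ne_zero _ (((N₂ : ℤ) - k) * (N₂ + k + 1))]
      ring
    · have e1 : ∀ x y f f' f₂ g g' g₂ A B C D E F G H I J : K,
          x * (f * f' * g₂) * (f₂ * A * B * (C * D * g' * E * F * g - y * (G * H * g * I * J * g'))) =
            (f * g) * (f' * g') * (f₂ * g₂) *
              (x * A * B * (C * D * E * F - y * (G * H * I * J))) :=
        fun _ _ _ _ _ _ _ _ _ _ _ _ _ _ _ _ _ _ => by ring
      rw [e1, h3, h4, h5, one_mul, one_mul, one_mul]
  rw [Finset.sum_congr rfl fun N₁ h₁ => Finset.sum_congr rfl fun N₂ h₂ => inner N₁ h₁ N₂ h₂,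
    Finset.mul_sum, Finset.sum_congr rfl middle]
  rcases lt_or_ge (L : ℤ) (k + 1) with hk | hk
  · rw [qi_of_neg q (show (L : ℤ) - 3 * k - 1 < 0 by omega),
      qi_of_neg q (show (L : ℤ) - 3 * k - 2 < 0 by omega)]
    simp only [zero_mul, mul_zero, sub_zero]
    refine Finset.sum_eq_zero fun N₁ _ => ?_
    rw [qi_of_neg q (show (L : ℤ) - N₁ - 2 * k - 1 < 0 by omega),
      qi_of_neg q (show (L : ℤ) - N₁ - 2 * k - 2 < 0 by omega)]
    simp
  -- The two terms left by the companion sum are both of Vandermonde type, each producing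
  -- (q;q)_{2L}.
  have h := sum_qVandermonde_window hq (L + k) (L - 3 * k - 1) (c := 2 * k + 1) (k := k)
    (R := L) (by omega) (by omega)
  have h' := sum_qVandermonde_window hq (L + k + 1) (L - 3 * k - 2) (c := 2 * k + 1) (k := k)
    (R := L) (by omega) (by omega)
  rw [show (L : ℤ) + k + (L - 3 * k - 1) + (2 * k + 1) = 2 * L by ring,
    show (L : ℤ) + k + (2 * k + 1) = L + 3 * k + 1 by ring,
    show (L : ℤ) - 3 * k - 1 + (2 * k + 1) = L - k by ring] at h
  rw [show (L : ℤ) + k + 1 + (L - 3 * k - 2) + (2 * k + 1) = 2 * L by ring,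
    show (L : ℤ) + k + 1 + (2 * k + 1) = L + 3 * k + 2 by ring,
    show (L : ℤ) - 3 * k - 2 + (2 * k + 1) = L - k - 1 by ring] at h'
  have h3 := hq.qf_mul_qi (show 0 ≤ (L : ℤ) + k by omega)
  have h4 := hq.qf_mul_qi (show 0 ≤ (L : ℤ) - k by omega)
  have h5 := hq.qf_mul_qi (show 0 ≤ (L : ℤ) + k + 1 by omega)
  have h6 := hq.qf_mul_qi (show 0 ≤ (L : ℤ) - k - 1 by omega)
  trans q ^ (3 * (k : ℤ) ^ 2 + 3 * k) * ((qf q (L + k) * qf q (L - k)) * (qf q (2 * L) *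
    qi q (L + k) * qi q (L - 3 * k - 1) * qi q (L + 3 * k + 1) * qi q (L - k)) -
      q ^ (2 * (k : ℤ) + 1) * ((qf q (L + k + 1) * qf q (L - k - 1)) * (qf q (2 * L) *
        qi q (L + k + 1) * qi q (L - 3 * k - 2) * qi q (L + 3 * k + 2) * qi q (L - k - 1))))
  · rw [← h, ← h', Finset.mul_sum, Finset.mul_sum, Finset.mul_sum, ← Finset.sum_sub_distrib,
      Finset.mul_sum]
    refine Finset.sum_congr rfl fun N₁ _ => ?_
    rw [show (N₁ : ℤ) - k + (2 * k + 1) = N₁ + k + 1 by ring,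
      show (L : ℤ) + k - (N₁ - k) = L - N₁ + 2 * k by ring,
      show (L : ℤ) + k + 1 - (N₁ - k) = L - N₁ + 2 * k + 1 by ring,
      show (L : ℤ) - 3 * k - 1 - (N₁ - k) = L - N₁ - 2 * k - 1 by ring,
      show (L : ℤ) - 3 * k - 2 - (N₁ - k) = L - N₁ - 2 * k - 2 by ring,
      show (N₁ : ℤ) ^ 2 + N₁ + 2 * (k ^ 2 + k) = 3 * k ^ 2 + 3 * k + (N₁ - k) * (N₁ + k + 1) by
        ring,
      zpow_add₀ hq.ne_zero _ (((N₁ : ℤ) - k) * (N₁ + k + 1))]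
    ring
  · have e1 : ∀ A B C D x y z : K, (A * B) * (x * C * y * z * D) = (A * C) * (B * D) * (x * y * z) :=
      fun _ _ _ _ _ _ _ => by ring
    rw [e1, e1, h3, h4, h5, h6]
    ring

end Nested

/-! ### Bilateral sums and the expansion of 1/(q;q)_N over the kernels. -/

section Bilateral

/-- The exponent `k (k - 1) / 2`, for integers `k`. -/
def tri (k : ℤ) : ℤ := k * (k - 1) / 2

theorem two_mul_tri (k : ℤ) : 2 * tri k = k * (k - 1) :=
  Int.mul_ediv_cancel' (Int.even_mul_pred_self k).two_dvd

theorem tri_add (a b : ℤ) : tri (a + b) = tri a + tri b + a * b := by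
  linarith [two_mul_tri a, two_mul_tri b, two_mul_tri (a + b)]

theorem tri_neg_one_sub (k : ℤ) : tri (-1 - k) = tri k + 2 * k + 1 := by
  linarith [two_mul_tri k, two_mul_tri (-1 - k)]

theorem tri_nonneg (k : ℤ) : 0 ≤ tri k := by
  have h := two_mul_tri k
  rcases lt_or_ge k 1 with hk | hk <;> nlinarith

theorem tri_natCast (n : ℕ) : tri n = n.choose 2 := by
  induction n with
  | zero => rfl
  | succ n ih =>
    rw [Nat.choose_succ_succ', Nat.choose_one_right]
    push_cast
    rw [tri_add, ih, show tri 1 = 0 from rfl]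
    ring

variable {K : Type*} [Field K] {q : K}

theorem neg_one_zpow_three_mul (k : ℤ) : (-1 : K) ^ (3 * k) = (-1) ^ k := by
  rw [zpow_mul]
  norm_num

theorem sum_Ico_eq_sum_range {f : ℤ → K} {M s : ℤ} {n : ℕ}
    (hf : ∀ k, k + s < 0 ∨ n < k + s → f k = 0) (h1 : s ≤ M) (h2 : n - s < M) :
    ∑ k ∈ Finset.Ico (-M) M, f k = ∑ j ∈ Finset.range (n + 1), f (j - s) := by
  have h3 : ∑ j ∈ Finset.range (n + 1), f (j - s) =
      ∑ k ∈ Finset.image (fun j : ℕ => (j : ℤ) - s) (Finset.range (n + 1)), f k := by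
    rw [Finset.sum_image]
    intro a _ b _ h
    simpa using h
  rw [h3]
  symm
  refine Finset.sum_subset ?_ ?_
  · intro k hk
    simp only [Finset.mem_image, Finset.mem_range, Finset.mem_Ico] at hk ⊢
    obtain ⟨j, hj, rfl⟩ := hk
    omega
  · intro k _ hk
    simp only [Finset.mem_image, Finset.mem_range, not_exists, not_and] at hk
    refine hf k ?_
    by_contra! h
    exact hk (k + s).toNat (by omega) (by omega)

/-- The half-open window is stable under k ↦ -1-k, the symmetry of the odd kernel; it also splits
evenly into residue classes mod 3. -/
theorem sum_Ico_neg_eq (f : ℤ → K) (M : ℕ) :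
    ∑ k ∈ Finset.Ico (-M : ℤ) M, f k = ∑ k ∈ Finset.range M, (f k + f (-1 - k)) := by
  induction M with
  | zero => simp
  | succ M ih =>
    have h : Finset.Ico (-(M + 1 : ℕ) : ℤ) (M + 1 : ℕ) =
        insert (M : ℤ) (insert (-1 - M : ℤ) (Finset.Ico (-M : ℤ) M)) := by
      ext k
      simp only [Finset.mem_insert, Finset.mem_Ico]
      omega
    rw [h, Finset.sum_insert, Finset.sum_insert, ih, Finset.sum_range_succ]
    · ring
    · simp only [Finset.mem_Ico]
      omega
    · simp only [Finset.mem_insert, Finset.mem_Ico]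
      omega

theorem sum_Ico_reflect (f : ℤ → K) (M : ℕ) :
    ∑ k ∈ Finset.Ico (-M : ℤ) M, f (-1 - k) = ∑ k ∈ Finset.Ico (-M : ℤ) M, f k := by
  rw [sum_Ico_neg_eq, sum_Ico_neg_eq]
  refine Finset.sum_congr rfl fun k _ => ?_
  rw [sub_sub_cancel, add_comm]

theorem sum_Ico_three_mul (f : ℤ → K) (M : ℕ) :
    ∑ i ∈ Finset.Ico (-(3 * M) : ℤ) (3 * M), f i =
      ∑ k ∈ Finset.Ico (-M : ℤ) M, (f (3 * k) + f (3 * k + 1) + f (3 * k + 2)) := by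
  have h : ∑ i ∈ Finset.Ico (-(3 * M : ℕ) : ℤ) (3 * M : ℕ), f i =
      ∑ k ∈ Finset.Ico (-M : ℤ) M, (f (3 * k) + f (3 * k + 1) + f (3 * k + 2)) := by
    rw [sum_Ico_neg_eq, sum_Ico_neg_eq]
    induction M with
    | zero => simp
    | succ M ih =>
      rw [Finset.sum_range_succ, ← ih, show 3 * (M + 1) = 3 * M + 1 + 1 + 1 by ring,
        Finset.sum_range_succ, Finset.sum_range_succ, Finset.sum_range_succ]
      push_cast
      ring_nf
  exact_mod_cast h

/-- The unit Bailey pair relative to 1. After a shift by r this is the q-binomial theorem at z =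
q^{-r} with 2r factors, and for r > 0 the factor with index r is zero. -/
theorem sum_alternating_even (hq : Generic q) {r M : ℕ} (hr : r < M) :
    ∑ k ∈ Finset.Ico (-M : ℤ) M, (-1) ^ k * q ^ tri k * (qi q (r - k) * qi q (r + k)) =
      if r = 0 then 1 else 0 := by
  have hq0 := hq.ne_zero
  rw [sum_Ico_eq_sum_range (s := r) (n := 2 * r) ?_ (by omega) (by push_cast; omega)]
  · split_ifs with h
    · subst h
      simp [qi_zero, tri]
    · have h1 := sum_qBinomial hq (q ^ (-r : ℤ)) (2 * r)
      have h2 : qShifted (q ^ (-r : ℤ)) q (2 * r) = 0 := by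
        refine Finset.prod_eq_zero (Finset.mem_range.2 (show r < 2 * r by omega)) ?_
        rw [← zpow_natCast, ← zpow_add₀ hq0, neg_add_cancel, zpow_zero, sub_self]
      rw [h2, zero_mul] at h1
      rw [← mul_zero ((-1) ^ (-r : ℤ) * q ^ tri (-r)), ← h1, Finset.mul_sum]
      refine Finset.sum_congr rfl fun j _ => ?_
      rw [← zpow_natCast q (j.choose 2), ← tri_natCast, ← zpow_natCast (q ^ (-r : ℤ)), ← zpow_mul,
        sub_eq_add_neg (j : ℤ), tri_add, zpow_add₀ (neg_ne_zero.2 one_ne_zero), zpow_natCast,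
        show (r : ℤ) - (j + -r) = (2 * r : ℕ) - j by push_cast; ring,
        show (r : ℤ) + (j + -r) = j by ring, zpow_add₀ hq0, zpow_add₀ hq0, mul_comm (j : ℤ)]
      ring
  · intro k hk
    rcases hk with hk | hk
    · rw [qi_of_neg q (show r + k < 0 by omega)]
      simp
    · rw [qi_of_neg q (show r - k < 0 by push_cast at hk; omega)]
      simp

/-- The unit Bailey pair relative to q: now z = q^{-(r+1)} with 2r+1 factors, and the factor with
index r+1 is present exactly when r > 0. For r = 0 the terms k = 0 and k = -1 add up to (1-q)/(1-q).
-/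
theorem sum_alternating_odd (hq : Generic q) {r M : ℕ} (hr : r < M) :
    ∑ k ∈ Finset.Ico (-M : ℤ) M, (-1) ^ k * q ^ tri k * (qi q (r - k) * qi q (r + k + 1)) =
      if r = 0 then 1 else 0 := by
  have hq0 := hq.ne_zero
  rw [sum_Ico_eq_sum_range (s := r + 1) (n := 2 * r + 1) ?_ (by omega) (by push_cast; omega)]
  · split_ifs with h
    · subst h
      have h1 := hq.qi_sub_one 1
      rw [sub_self, qi_zero, zpow_one] at h1
      simp only [Finset.sum_range_succ, Finset.sum_range_zero]
      norm_num [tri, qi_zero]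
      linear_combination -h1
    · have h1 := sum_qBinomial hq (q ^ (-(r + 1 : ℤ))) (2 * r + 1)
      have h2 : qShifted (q ^ (-(r + 1 : ℤ))) q (2 * r + 1) = 0 := by
        refine Finset.prod_eq_zero (Finset.mem_range.2 (show r + 1 < 2 * r + 1 by omega)) ?_
        rw [← zpow_natCast, ← zpow_add₀ hq0, Nat.cast_succ, neg_add_cancel, zpow_zero, sub_self]
      rw [h2, zero_mul] at h1
      rw [← mul_zero ((-1) ^ (-(r + 1 : ℤ)) * q ^ tri (-(r + 1 : ℤ))), ← h1, Finset.mul_sum]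
      refine Finset.sum_congr rfl fun j _ => ?_
      rw [← zpow_natCast q (j.choose 2), ← tri_natCast, ← zpow_natCast (q ^ (-(r + 1) : ℤ)),
        ← zpow_mul, sub_eq_add_neg (j : ℤ), tri_add, zpow_add₀ (neg_ne_zero.2 one_ne_zero),
        zpow_natCast, show (r : ℤ) - (j + -(r + 1)) = (2 * r + 1 : ℕ) - j by push_cast; ring,
        show (r : ℤ) + (j + -(r + 1)) + 1 = j by ring, zpow_add₀ hq0, zpow_add₀ hq0,
        mul_comm (j : ℤ)]
      ring
  · intro k hk
    rcases hk with hk | hk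
    · rw [qi_of_neg q (show r + k + 1 < 0 by omega)]
      simp
    · rw [qi_of_neg q (show r - k < 0 by push_cast at hk; omega)]
      simp

/-- One step of the Bailey chain with both parameters sent to infinity. For k ≥ 0 it is the limiting
Vandermonde sum with c = 2k; the kernel is symmetric under k ↦ -k. -/
theorem qi_mul_qi_even (hq : Generic q) {N R : ℕ} (hN : N < R) (k : ℤ) :
    q ^ (k ^ 2) * (qi q (N - k) * qi q (N + k)) =
      ∑ r ∈ Finset.range R, q ^ ((r : ℤ) ^ 2) * qi q (N - r) * (qi q (r - k) * qi q (r + k)) := by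
  have h : ∀ k : ℕ, q ^ ((k : ℤ) ^ 2) * (qi q (N - k) * qi q (N + k)) =
      ∑ r ∈ Finset.range R,
        q ^ ((r : ℤ) ^ 2) * qi q (N - r) * (qi q (r - k) * qi q (r + k)) := by
    intro k
    have h := sum_qVandermonde_limit_window hq (N - k) (c := 2 * k) (k := k) (R := R)
      (by omega) (by omega)
    rw [show (N : ℤ) - k + 2 * k = N + k by ring] at h
    rw [← h, Finset.mul_sum]
    refine Finset.sum_congr rfl fun r _ => ?_
    rw [show (r : ℤ) - k + 2 * k = r + k by ring, show (N : ℤ) - k - (r - k) = N - r by ring,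
      show (r : ℤ) ^ 2 = k ^ 2 + (r - k) * (r + k) by ring, zpow_add₀ hq.ne_zero]
    ring
  obtain ⟨n, rfl | rfl⟩ := k.eq_nat_or_neg
  · exact h n
  · simp only [neg_sq, sub_neg_eq_add, ← sub_eq_add_neg, mul_comm (qi q (_ + (n : ℤ)))]
    exact h n

theorem qi_mul_qi_odd (hq : Generic q) {N R : ℕ} (hN : N < R) (k : ℤ) :
    q ^ (k ^ 2 + k) * (qi q (N - k) * qi q (N + k + 1)) =
      ∑ r ∈ Finset.range R,
        q ^ ((r : ℤ) ^ 2 + r) * qi q (N - r) * (qi q (r - k) * qi q (r + k + 1)) := by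
  have h : ∀ k : ℕ, q ^ ((k : ℤ) ^ 2 + k) * (qi q (N - k) * qi q (N + k + 1)) =
      ∑ r ∈ Finset.range R,
        q ^ ((r : ℤ) ^ 2 + r) * qi q (N - r) * (qi q (r - k) * qi q (r + k + 1)) := by
    intro k
    have h := sum_qVandermonde_limit_window hq (N - k) (c := 2 * k + 1) (k := k) (R := R)
      (by omega) (by omega)
    rw [show (N : ℤ) - k + (2 * k + 1) = N + k + 1 by ring] at h
    rw [← h, Finset.mul_sum]
    refine Finset.sum_congr rfl fun r _ => ?_
    rw [show (r : ℤ) - k + (2 * k + 1) = r + k + 1 by ring,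
      show (N : ℤ) - k - (r - k) = N - r by ring,
      show (r : ℤ) ^ 2 + r = k ^ 2 + k + (r - k) * (r + k + 1) by ring,
      zpow_add₀ hq.ne_zero (k ^ 2 + k)]
    ring
  rcases lt_or_ge k 0 with hk | hk
  · obtain ⟨n, rfl⟩ : ∃ n : ℕ, k = -1 - n := ⟨(-1 - k).toNat, by omega⟩
    have e1 : ∀ z : ℤ, qi q (z - (-1 - n)) * qi q (z + (-1 - n) + 1) =
        qi q (z - n) * qi q (z + n + 1) := fun z => by
      rw [mul_comm]
      ring_nf
    simp only [e1, show (-1 - (n : ℤ)) ^ 2 + (-1 - n) = n ^ 2 + n by ring]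
    exact h n
  · lift k to ℕ using hk
    exact h k

/-- Weighting the orthogonality relation `sum_alternating_even` by q^{r²}/(q;q)_{N-r} leaves only r
= 0. Interchanging the sums lets `qi_mul_qi_even` resum over r. -/
theorem qi_eq_sum_even (hq : Generic q) {N M : ℕ} (hN : N < M) :
    qi q N = ∑ k ∈ Finset.Ico (-M : ℤ) M,
      (-1) ^ k * q ^ (tri k + k ^ 2) * (qi q (N - k) * qi q (N + k)) := by
  calc qi q N = ∑ r ∈ Finset.range M, q ^ ((r : ℤ) ^ 2) * qi q (N - r) *
        ∑ k ∈ Finset.Ico (-M : ℤ) M, (-1) ^ k * q ^ tri k * (qi q (r - k) * qi q (r + k)) := by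
        rw [Finset.sum_congr rfl fun r hr => by
          rw [sum_alternating_even hq (Finset.mem_range.1 hr)]]
        rw [Finset.sum_eq_single 0]
        · simp
        · intro b _ hb
          simp [hb]
        · intro h
          exact absurd (Finset.mem_range.2 (by omega)) h
    _ = _ := by
        simp only [Finset.mul_sum]
        rw [Finset.sum_comm]
        refine Finset.sum_congr rfl fun k _ => ?_
        rw [zpow_add₀ hq.ne_zero, ← mul_assoc ((-1) ^ k), mul_assoc ((-1) ^ k * q ^ tri k),
          qi_mul_qi_even hq hN, Finset.mul_sum]
        exact Finset.sum_congr rfl fun r _ => by ring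

theorem qi_eq_sum_odd (hq : Generic q) {N M : ℕ} (hN : N < M) :
    qi q N = ∑ k ∈ Finset.Ico (-M : ℤ) M,
      (-1) ^ k * q ^ (tri k + k ^ 2 + k) * (qi q (N - k) * qi q (N + k + 1)) := by
  calc qi q N = ∑ r ∈ Finset.range M, q ^ ((r : ℤ) ^ 2 + r) * qi q (N - r) *
        ∑ k ∈ Finset.Ico (-M : ℤ) M,
          (-1) ^ k * q ^ tri k * (qi q (r - k) * qi q (r + k + 1)) := by
        rw [Finset.sum_congr rfl fun r hr => by
          rw [sum_alternating_odd hq (Finset.mem_range.1 hr)]]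
        rw [Finset.sum_eq_single 0]
        · simp
        · intro b _ hb
          simp [hb]
        · intro h
          exact absurd (Finset.mem_range.2 (by omega)) h
    _ = _ := by
        simp only [Finset.mul_sum]
        rw [Finset.sum_comm]
        refine Finset.sum_congr rfl fun k _ => ?_
        rw [add_assoc, zpow_add₀ hq.ne_zero, ← mul_assoc ((-1) ^ k),
          mul_assoc ((-1) ^ k * q ^ tri k), qi_mul_qi_odd hq hN, Finset.mul_sum]
        exact Finset.sum_congr rfl fun r _ => by ring

end Bilateral

/-! ### The fermionic sums as bilateral sums. -/

section TripleSums

variable {K : Type*} [Field K] {q : K}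

theorem triple_sum_even_eq (hq : Generic q) (L : ℕ) :
    ∑ N₁ ∈ Finset.range (L + 1), ∑ N₂ ∈ Finset.range (L + 1), ∑ N₃ ∈ Finset.range (L + 1),
        q ^ ((N₁ : ℤ) ^ 2 + N₂ ^ 2 + N₃ ^ 2) * qf q (L - N₁) * qf q (2 * L - N₁ - N₂) *
          qi q (2 * L - 2 * N₁) * qi q (L - N₁ - N₂ - N₃) * qi q (N₁ - N₂) * qi q (N₂ - N₃) *
            qi q N₃ =
      ∑ k ∈ Finset.Ico (-(L + 1 : ℕ) : ℤ) (L + 1 : ℕ),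
        (-1) ^ k * q ^ (tri k + 4 * k ^ 2) * (qf q (2 * L) * qi q (L - 3 * k) * qi q (L + 3 * k)) := by
  have key : ∀ k : ℤ,
      ∑ N₁ ∈ Finset.range (L + 1), ∑ N₂ ∈ Finset.range (L + 1), ∑ N₃ ∈ Finset.range (L + 1),
        q ^ ((N₁ : ℤ) ^ 2 + N₂ ^ 2 + N₃ ^ 2) * qf q (L - N₁) * qf q (2 * L - N₁ - N₂) *
          qi q (2 * L - 2 * N₁) * qi q (L - N₁ - N₂ - N₃) * qi q (N₁ - N₂) * qi q (N₂ - N₃) *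
            (qi q (N₃ - k) * qi q (N₃ + k)) =
      q ^ (3 * k ^ 2) * qf q (2 * L) * qi q (L - 3 * k) * qi q (L + 3 * k) := by
    intro k
    obtain ⟨n, rfl | rfl⟩ := k.eq_nat_or_neg
    · exact triple_sum_even hq L n
    · have e1 : ∀ z : ℤ, qi q (z - -n) * qi q (z + -n) = qi q (z - n) * qi q (z + n) := fun z => by
        rw [mul_comm, sub_neg_eq_add, ← sub_eq_add_neg]
      simp only [e1]
      rw [triple_sum_even hq L n, mul_neg, sub_neg_eq_add, ← sub_eq_add_neg, neg_sq]
      ring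
  have expandN₃ : ∀ N₃ ∈ Finset.range (L + 1), qi q N₃ =
      ∑ k ∈ Finset.Ico (-(L + 1 : ℕ) : ℤ) (L + 1 : ℕ),
        (-1) ^ k * q ^ (tri k + k ^ 2) * (qi q (N₃ - k) * qi q (N₃ + k)) := fun N₃ h =>
    qi_eq_sum_even hq (Finset.mem_range.1 h)
  rw [Finset.sum_congr rfl fun N₁ _ => Finset.sum_congr rfl fun N₂ _ =>
    Finset.sum_congr rfl fun N₃ h₃ => by rw [expandN₃ N₃ h₃, Finset.mul_sum]]
  rw [Finset.sum_congr rfl fun N₁ _ => Finset.sum_congr rfl fun N₂ _ => Finset.sum_comm]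
  rw [Finset.sum_congr rfl fun N₁ _ => Finset.sum_comm, Finset.sum_comm]
  refine Finset.sum_congr rfl fun k _ => ?_
  rw [show tri k + 4 * k ^ 2 = tri k + k ^ 2 + 3 * k ^ 2 by ring,
    zpow_add₀ hq.ne_zero (tri k + k ^ 2)]
  trans (-1) ^ k * q ^ (tri k + k ^ 2) *
    (q ^ (3 * k ^ 2) * qf q (2 * L) * qi q (L - 3 * k) * qi q (L + 3 * k))
  · rw [← key k]
    simp only [Finset.mul_sum]
    exact Finset.sum_congr rfl fun N₁ _ => Finset.sum_congr rfl fun N₂ _ =>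
      Finset.sum_congr rfl fun N₃ _ => by ring
  · ring

/-- `triple_sum_odd` evaluates the sum only together with the factor 1 - q^{2k+1}, so the expansion
is folded to k ≥ 0 first: the terms k and -1-k share a kernel and have opposite signs, which
produces that factor. The two terms of the value then unfold to k and -1-k on the right. -/
theorem triple_sum_odd_eq (hq : Generic q) (L : ℕ) :
    ∑ N₁ ∈ Finset.range L, ∑ N₂ ∈ Finset.range L, ∑ N₃ ∈ Finset.range L,
        q ^ ((N₁ : ℤ) ^ 2 + N₂ ^ 2 + N₃ ^ 2 + N₁ + N₂ + N₃) * qf q (L - N₁ - 1) *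
          qf q (2 * L - N₁ - N₂ - 1) * qi q (2 * L - 2 * N₁ - 1) *
          qi q (L - N₁ - N₂ - N₃ - 1) * qi q (N₁ - N₂) * qi q (N₂ - N₃) * qi q N₃ =
      ∑ k ∈ Finset.Ico (-(L + 1 : ℕ) : ℤ) (L + 1 : ℕ),
        (-1) ^ k * q ^ (tri k + 4 * k ^ 2 + 4 * k) *
          (qf q (2 * L) * qi q (L - 3 * k - 1) * qi q (L + 3 * k + 1)) := by
  have sign : ∀ k : ℕ, (-1 : K) ^ (-1 - k : ℤ) = -(-1) ^ (k : ℤ) := fun k => by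
    rw [zpow_sub₀ (neg_ne_zero.2 one_ne_zero), zpow_natCast]
    rcases Nat.even_or_odd k with h | h <;> simp [h.neg_one_pow]
  have expandN₃ : ∀ N₃ ∈ Finset.range L, qi q N₃ =
      ∑ k ∈ Finset.range (L + 1), (-1) ^ (k : ℤ) * q ^ (tri k + k ^ 2 + k) *
        ((1 - q ^ (2 * (k : ℤ) + 1)) * (qi q (N₃ - k) * qi q (N₃ + k + 1))) := by
    intro N₃ h
    have h' : N₃ < L + 1 := (Finset.mem_range.1 h).trans L.lt_succ_self
    rw [qi_eq_sum_odd hq h', sum_Ico_neg_eq]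
    refine Finset.sum_congr rfl fun k _ => ?_
    rw [sign, tri_neg_one_sub, show tri k + 2 * k + 1 + (-1 - (k : ℤ)) ^ 2 + (-1 - k) =
        tri k + k ^ 2 + k + (2 * k + 1) by ring, zpow_add₀ hq.ne_zero _ (2 * (k : ℤ) + 1),
      show (N₃ : ℤ) - (-1 - k) = N₃ + k + 1 by ring, show (N₃ : ℤ) + (-1 - k) + 1 = N₃ - k by ring]
    ring
  rw [Finset.sum_congr rfl fun N₁ _ => Finset.sum_congr rfl fun N₂ _ =>
    Finset.sum_congr rfl fun N₃ h₃ => by rw [expandN₃ N₃ h₃, Finset.mul_sum]]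
  rw [Finset.sum_congr rfl fun N₁ _ => Finset.sum_congr rfl fun N₂ _ => Finset.sum_comm]
  rw [Finset.sum_congr rfl fun N₁ _ => Finset.sum_comm, Finset.sum_comm, sum_Ico_neg_eq]
  refine Finset.sum_congr rfl fun k _ => ?_
  trans (-1) ^ (k : ℤ) * q ^ (tri k + k ^ 2 + k) *
    (q ^ (3 * (k : ℤ) ^ 2 + 3 * k) * qf q (2 * L) *
        (qi q (L - 3 * k - 1) * qi q (L + 3 * k + 1) -
          q ^ (2 * (k : ℤ) + 1) * (qi q (L - 3 * k - 2) * qi q (L + 3 * k + 2))))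
  · rw [← triple_sum_odd hq]
    simp only [Finset.mul_sum]
    exact Finset.sum_congr rfl fun N₁ _ => Finset.sum_congr rfl fun N₂ _ =>
      Finset.sum_congr rfl fun N₃ _ => by ring
  · rw [sign, tri_neg_one_sub, show tri k + 2 * k + 1 + 4 * (-1 - (k : ℤ)) ^ 2 + 4 * (-1 - k) =
        tri k + k ^ 2 + k + (3 * k ^ 2 + 3 * k) + (2 * k + 1) by ring,
      show tri k + 4 * (k : ℤ) ^ 2 + 4 * k = tri k + k ^ 2 + k + (3 * k ^ 2 + 3 * k) by ring,
      zpow_add₀ hq.ne_zero _ (2 * (k : ℤ) + 1),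
      zpow_add₀ hq.ne_zero (tri k + (k : ℤ) ^ 2 + k),
      show (L : ℤ) - 3 * (-1 - k) - 1 = L + 3 * k + 2 by ring,
      show (L : ℤ) + 3 * (-1 - k) + 1 = L - 3 * k - 2 by ring]
    ring

/-- Passing from the differences `n₁, n₂, n₃` to the partial sums `N₁, N₂, N₃`. -/
theorem sum_triples_eq {S : ℕ} (f : ℕ × ℕ × ℕ → K) (g : ℕ → ℕ → ℕ → K)
    (hfg : ∀ n ∈ triples S, f n = g (bigN₁ n) (bigN₂ n) (bigN₃ n))
    (hg : ∀ N₁ N₂ N₃, ¬ (N₃ ≤ N₂ ∧ N₂ ≤ N₁ ∧ N₁ + N₂ + N₃ < S) → g N₁ N₂ N₃ = 0) :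
    ∑ n ∈ triples S, f n = ∑ N₁ ∈ Finset.range S, ∑ N₂ ∈ Finset.range S,
      ∑ N₃ ∈ Finset.range S, g N₁ N₂ N₃ := by
  have h : ∑ N₁ ∈ Finset.range S, ∑ N₂ ∈ Finset.range S, ∑ N₃ ∈ Finset.range S, g N₁ N₂ N₃ =
      ∑ N ∈ (Finset.range S ×ˢ Finset.range S ×ˢ Finset.range S).filter
        (fun N => N.2.2 ≤ N.2.1 ∧ N.2.1 ≤ N.1 ∧ N.1 + N.2.1 + N.2.2 < S), g N.1 N.2.1 N.2.2 := by
    rw [Finset.sum_filter_of_ne]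
    · simp only [Finset.sum_product]
    · intro N _ hN
      by_contra hlt
      exact hN (hg _ _ _ hlt)
  rw [h]
  refine Finset.sum_nbij' (fun n => (bigN₁ n, bigN₂ n, bigN₃ n))
    (fun N => (N.1 - N.2.1, N.2.1 - N.2.2, N.2.2)) ?_ ?_ ?_ ?_ hfg
  · intro n hn
    rw [mem_triples] at hn
    simp only [bigN₁, bigN₂, bigN₃, Finset.mem_filter, Finset.mem_product, Finset.mem_range]
      at hn ⊢
    omega
  · intro N hN
    rw [mem_triples]
    simp only [bigN₁, bigN₂, bigN₃, Finset.mem_filter, Finset.mem_product, Finset.mem_range]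
      at hN ⊢
    omega
  · rintro ⟨a, b, c⟩ _
    refine Prod.ext_iff.2 ⟨?_, Prod.ext_iff.2 ⟨?_, ?_⟩⟩ <;>
      simp only [bigN₁, bigN₂, bigN₃] <;> omega
  · rintro ⟨a, b, c⟩ hN
    simp only [Finset.mem_filter] at hN
    refine Prod.ext_iff.2 ⟨?_, Prod.ext_iff.2 ⟨?_, ?_⟩⟩ <;>
      simp only [bigN₁, bigN₂, bigN₃] <;> omega

end TripleSums

/-! ### The Borwein polynomials as bilateral sums. -/

section Borwein

variable {K : Type*} [Field K] [Algebra ℤ K]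

/-- The Gaussian binomial coefficients are polynomials in `q` with integer coefficients. -/
theorem exists_gaussian_polynomial (K : Type*) [Field K] [Algebra ℤ K] (n : ℕ) (z : ℤ) :
    ∃ p : ℤ[X], ∀ q : K, Generic q → aeval q p = qf q n * qi q z * qi q (n - z) := by
  induction n generalizing z with
  | zero =>
    rcases eq_or_ne z 0 with rfl | hz
    · exact ⟨1, fun q _ => by simp [qf, qShifted, qi_zero]⟩
    · refine ⟨0, fun q _ => ?_⟩
      rcases hz.lt_or_gt with h | h
      · simp [qi_of_neg q h]
      · simp [qi_of_neg q (show -z < 0 by omega)]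
  | succ n ih =>
    obtain ⟨p₁, h₁⟩ := ih z
    obtain ⟨p₂, h₂⟩ := ih (z - 1)
    rcases lt_or_ge ((n : ℤ) + 1 - z) 0 with h | h
    · refine ⟨0, fun q _ => ?_⟩
      rw [qi_of_neg q (show ((n + 1 : ℕ) : ℤ) - z < 0 by push_cast; omega)]
      simp
    -- The q-Pascal rule [n+1, z] = [n, z] + q^{n+1-z} [n, z-1].
    · refine ⟨p₁ + X ^ ((n : ℤ) + 1 - z).toNat * p₂, fun q hq => ?_⟩
      have e1 := hq.qi_sub_one z
      have e2 := hq.qi_sub_one ((n : ℤ) + 1 - z)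
      have e3 : q ^ ((n : ℤ) + 1 - z) * q ^ z = q ^ ((n : ℤ) + 1) := by
        rw [← zpow_add₀ hq.ne_zero, sub_add_cancel]
      have e4 := qf_eq_mul q (show 0 < (n : ℤ) + 1 by omega)
      rw [add_sub_cancel_right] at e4
      rw [map_add, map_mul, map_pow, aeval_X, h₁ q hq, h₂ q hq, ← zpow_natCast,
        Int.toNat_of_nonneg h, Nat.cast_succ, e4, ← e3,
        show (n : ℤ) - z = n + 1 - z - 1 by ring, show (n : ℤ) - (z - 1) = n + 1 - z by ring, e1, e2]
      ring

/-- This is the q-binomial theorem in base q³ with 2L factors and z = q^{1-3L}, re-indexed by i = j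
- L. The upper L factors form (q;q³)_L; the lower ones, reversed, are 1 - q^{-(3j+2)} = -q^{-(3j+2)}
(1 - q^{3j+2}) and form (q²;q³)_L up to a monomial. -/
theorem aeval_borweinProduct {q : K} (hq : Generic q) (L : ℕ) :
    aeval q (borweinProduct L) = ∑ i ∈ Finset.Ico (-(3 * (L + 1 : ℕ)) : ℤ) (3 * (L + 1 : ℕ)),
      (-1) ^ i * q ^ (3 * tri i + i) *
        (qf (q ^ 3) (2 * L) * qi (q ^ 3) (L + i) * qi (q ^ 3) (L - i)) := by
  have hq0 := hq.ne_zero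
  have hq3 := hq.pow three_ne_zero
  have h1 := sum_qBinomial hq3 (q ^ (-(3 * L) + 1 : ℤ)) (2 * L)
  have h2 : qShifted (q ^ (-(3 * L) + 1 : ℤ)) (q ^ 3) (2 * L) =
      (-1) ^ L * q ^ (-(3 * tri L + 2 * L)) * aeval q (borweinProduct L) := by
    have e1 : ∏ j ∈ Finset.range L, (1 - q ^ (-(3 * L) + 1 : ℤ) * (q ^ 3) ^ (L - 1 - j)) =
        ∏ j ∈ Finset.range L, (-q ^ (-(3 * j + 2 : ℤ)) * (1 - q ^ 2 * (q ^ 3) ^ j)) := by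
      refine Finset.prod_congr rfl fun j hj => ?_
      rw [Finset.mem_range] at hj
      rw [mul_sub, mul_one, neg_mul, sub_neg_eq_add, neg_add_eq_sub, ← pow_mul, ← pow_mul, ← pow_add,
        ← zpow_natCast, ← zpow_natCast, ← zpow_add₀ hq0, ← zpow_add₀ hq0]
      rw [show -(3 * (j : ℤ) + 2) + ((2 + 3 * j : ℕ) : ℤ) = 0 by push_cast; ring, zpow_zero,
        show 1 - 3 * L + ((3 * (L - 1 - j) : ℕ) : ℤ) = -(3 * (j : ℤ) + 2) by omega]
      ring
    have e2 : ∀ L : ℕ, ∏ j ∈ Finset.range L, (-q ^ (-(3 * j + 2 : ℤ))) =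
        (-1) ^ L * q ^ (-(3 * tri L + 2 * L)) := by
      intro L
      induction L with
      | zero => simp [tri]
      | succ L ih =>
        rw [Finset.prod_range_succ, ih, Nat.cast_succ, tri_add, show tri 1 = 0 from rfl,
          show -(3 * (tri L + 0 + (L : ℤ) * 1) + 2 * (L + 1)) =
            -(3 * tri L + 2 * L) + -(3 * L + 2) by ring, zpow_add₀ hq0 (-(3 * tri L + 2 * L))]
        ring
    rw [qShifted, two_mul, Finset.prod_range_add, ← Finset.prod_range_reflect, e1,
      Finset.prod_mul_distrib, e2, borweinProduct, map_mul]
    simp only [qShifted, map_prod, map_sub, map_one, map_mul, map_pow, aeval_X]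
    have e3 : ∀ j : ℕ, q ^ (-(3 * L) + 1 : ℤ) * (q ^ 3) ^ (L + j) = q * (q ^ 3) ^ j := fun j => by
      rw [← pow_mul, ← pow_mul, ← pow_succ', ← zpow_natCast, ← zpow_natCast, ← zpow_add₀ hq0]
      congr 1
      push_cast
      ring
    simp only [e3]
    ring
  rw [h2] at h1
  have h3 := hq3.qf_mul_qi (show 0 ≤ ((2 * L : ℕ) : ℤ) by omega)
  have hc : (-1 : K) ^ L * q ^ (-(3 * tri L + 2 * L)) ≠ 0 :=
    mul_ne_zero (pow_ne_zero _ (neg_ne_zero.2 one_ne_zero)) (zpow_ne_zero _ hq0)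
  have h4 : aeval q (borweinProduct L) = ((-1 : K) ^ L * q ^ (-(3 * tri L + 2 * L)))⁻¹ *
      qf (q ^ 3) (2 * L : ℕ) * ((-1) ^ L * q ^ (-(3 * tri L + 2 * L)) * aeval q (borweinProduct L) *
        qi (q ^ 3) (2 * L : ℕ)) := by
    rw [show ∀ a b c d e : K, a * b * (c * d * e) = a * c * (b * e) * d from
      fun _ _ _ _ _ => by ring, h3, inv_mul_cancel₀ hc, one_mul, one_mul]
  rw [h4, ← h1, sum_Ico_eq_sum_range (s := L) (n := 2 * L) ?_ (by push_cast; omega)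
    (by push_cast; omega), Finset.mul_sum]
  · refine Finset.sum_congr rfl fun j _ => ?_
    rw [mul_inv, ← zpow_neg, ← zpow_natCast (-1 : K) L, ← zpow_neg,
      ← zpow_natCast (-1 : K) j, ← zpow_natCast _ (j.choose 2), ← tri_natCast,
      ← zpow_natCast (q ^ (-(3 * L) + 1 : ℤ)), ← zpow_mul, ← zpow_natCast q 3, ← zpow_mul,
      show (L : ℤ) + (j - L) = j by ring, show (L : ℤ) - (j - L) = (2 * L : ℕ) - j by
        push_cast; ring, zpow_natCast q 3, Nat.cast_mul 2 L, Nat.cast_two,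
      sub_eq_add_neg (j : ℤ), zpow_add₀ (neg_ne_zero.2 one_ne_zero : (-1 : K) ≠ 0)]
    have e : 3 * tri (j + -L) + ((j : ℤ) + -L) = - -(3 * tri L + 2 * L) +
        (3 : ℕ) * tri j + (-(3 * L) + 1) * j := by
      rw [tri_add]
      push_cast
      linarith [two_mul_tri L, two_mul_tri (-L)]
    rw [e, zpow_add₀ hq0, zpow_add₀ hq0]
    ring
  · intro k hk
    rcases hk with hk | hk
    · rw [qi_of_neg _ (show L + k < 0 by omega)]
      simp
    · rw [qi_of_neg _ (show L - k < 0 by push_cast at hk; omega)]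
      simp

/-- The bilateral sums for the Borwein polynomials `A_L` and `C_L`. -/
theorem aeval_borwein {q : K} (hinj : Function.Injective (aeval (R := ℤ) q))
    (hq : Generic q) (L : ℕ) :
    aeval q (borweinA L) = ∑ k ∈ Finset.Ico (-(L + 1 : ℕ) : ℤ) (L + 1 : ℕ),
        (-1) ^ k * q ^ (tri k + 4 * k ^ 2) *
          (qf q (2 * L) * qi q (L - 3 * k) * qi q (L + 3 * k)) ∧
    aeval q (borweinC L) = ∑ k ∈ Finset.Ico (-(L + 1 : ℕ) : ℤ) (L + 1 : ℕ),
        (-1) ^ k * q ^ (tri k + 4 * k ^ 2 + 4 * k) *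
          (qf q (2 * L) * qi q (L - 3 * k - 1) * qi q (L + 3 * k + 1)) := by
  choose G hG using exists_gaussian_polynomial K (2 * L)
  set S := Finset.Ico (-(L + 1 : ℕ) : ℤ) (L + 1 : ℕ)
  -- The sums must be genuine polynomials, with Gaussian coefficients chosen independently of q: the
  -- defining relation uses their values at q³, the conclusion their values at q. All exponents used
  -- are nonnegative, so `toNat` loses nothing.
  let P : (ℤ → ℤ) → (ℤ → ℤ) → ℤ[X] := fun e z =>
    ∑ k ∈ S, (-1) ^ k.natAbs * X ^ (e k).toNat * G (L + z k)
  have hP : ∀ (q : K), Generic q → ∀ e z : ℤ → ℤ, (∀ k, 0 ≤ e k) → aeval q (P e z) =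
      ∑ k ∈ S, (-1) ^ k * q ^ e k * (qf q (2 * L) * qi q (L - z k) * qi q (L + z k)) := by
    intro q hq e z he
    simp only [P, map_sum, map_mul, map_pow, map_neg, map_one, aeval_X]
    refine Finset.sum_congr rfl fun k _ => ?_
    have e1 : (-1 : K) ^ k.natAbs = (-1) ^ k := by
      obtain ⟨n, rfl | rfl⟩ := k.eq_nat_or_neg
      · simp
      · rw [Int.natAbs_neg, Int.natAbs_natCast, zpow_neg, zpow_natCast, ← inv_pow, inv_neg_one]
    rw [hG _ q hq, e1, ← zpow_natCast q, Int.toNat_of_nonneg (he k),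
      show ((2 * L : ℕ) : ℤ) - (L + z k) = L - z k by push_cast; ring, Nat.cast_mul, Nat.cast_two]
    ring
  have hA : ∀ k, 0 ≤ tri k + 4 * k ^ 2 := fun k => by
    have := tri_nonneg k
    positivity
  have hB : ∀ k, 0 ≤ tri k + 4 * k ^ 2 + 3 * k := fun k => by
    have := tri_nonneg k
    rcases lt_or_ge k 0 with h | h <;> nlinarith
  have hC : ∀ k, 0 ≤ tri k + 4 * k ^ 2 + 4 * k := fun k => by
    have := tri_nonneg k
    rcases lt_or_ge k 0 with h | h <;> nlinarith
  have hABC : expand ℤ 3 (P (fun k => tri k + 4 * k ^ 2) fun k => 3 * k) -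
      X * expand ℤ 3 (P (fun k => tri k + 4 * k ^ 2 + 3 * k) fun k => 3 * k + 1) -
      X ^ 2 * expand ℤ 3 (P (fun k => tri k + 4 * k ^ 2 + 4 * k) fun k => 3 * k + 1) =
      borweinProduct L := by
    apply hinj
    have hq0 := hq.ne_zero
    have hq3 := hq.pow three_ne_zero
    have m1 : (-1 : K) ≠ 0 := neg_ne_zero.2 one_ne_zero
    simp only [map_sub, map_mul, map_pow, aeval_X, expand_aeval]
    -- The index i is split mod 3. Reflecting the class 3k+2 by k ↦ -1-k makes i = -(3k+1), matching
    -- the shift 3k+1 used for both other polynomials.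
    rw [hP _ hq3 _ _ hA, hP _ hq3 _ _ hB, hP _ hq3 _ _ hC, aeval_borweinProduct hq,
      sum_Ico_three_mul, Finset.sum_add_distrib, Finset.sum_add_distrib,
      ← sum_Ico_reflect (fun k => _ * (_ * qi _ (L + (3 * k + 2)) * _)),
      sub_eq_add_neg, sub_eq_add_neg, Finset.mul_sum, Finset.mul_sum, ← Finset.sum_neg_distrib,
      ← Finset.sum_neg_distrib]
    have hpow : ∀ z : ℤ, (q ^ 3) ^ z = q ^ (3 * z) := fun z => by
      rw [zpow_mul]
      exact_mod_cast rfl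
    simp only [hpow]
    congr 1
    · congr 1
      · refine Finset.sum_congr rfl fun k _ => ?_
        rw [neg_one_zpow_three_mul, show 3 * tri (3 * k) + 3 * k = 3 * (tri k + 4 * k ^ 2) by
          linarith [two_mul_tri k, two_mul_tri (3 * k)]]
        ring
      · refine Finset.sum_congr rfl fun k _ => ?_
        rw [zpow_add₀ m1, neg_one_zpow_three_mul,
          show 3 * tri (3 * k + 1) + (3 * k + 1) = 1 + 3 * (tri k + 4 * k ^ 2 + 3 * k) by
            linarith [two_mul_tri k, two_mul_tri (3 * k + 1)], zpow_add₀ hq0 1]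
        simp only [zpow_one]
        ring
    · refine Finset.sum_congr rfl fun k _ => ?_
      rw [show 3 * (-1 - k) + 2 = -(3 * k + 1) by ring,
        show 3 * tri (-(3 * k + 1)) + -(3 * k + 1) = 2 + 3 * (tri k + 4 * k ^ 2 + 4 * k) by
          linarith [two_mul_tri k, two_mul_tri (-(3 * k + 1))], zpow_add₀ hq0 2, zpow_neg,
        ← inv_zpow, inv_neg_one, zpow_add₀ m1, neg_one_zpow_three_mul, sub_neg_eq_add,
        ← sub_eq_add_neg]
      simp only [zpow_ofNat]
      ring
  -- Uniqueness of the trisection identifies the constructed polynomials with A_L and C_L.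
  obtain ⟨rA, -, rC⟩ := (borwein_iff L _ _ _).1 hABC
  rw [← rA, ← rC, hP q hq _ _ hA, hP q hq _ _ hC]
  refine ⟨rfl, Finset.sum_congr rfl fun k _ => ?_⟩
  rw [← sub_sub, ← add_assoc]

end Borwein

/-! ### Specialisation to ℚ(q). -/

theorem aeval_qVar_injective : Function.Injective (aeval (R := ℤ) qVar) := by
  have h : ∀ p : ℤ[X], aeval qVar p =
      algebraMap ℚ[X] (RatFunc ℚ) (p.map (Int.castRingHom ℚ)) := by
    intro p
    rw [qVar, ← RatFunc.algebraMap_X, aeval_algebraMap_apply, aeval_def,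
      RingHom.ext_int (algebraMap ℤ ℚ[X]) (C.comp (Int.castRingHom ℚ))]
    rfl
  intro a b hab
  rw [h, h] at hab
  exact map_injective _ Int.cast_injective (RatFunc.algebraMap_injective ℚ hab)

theorem generic_qVar : Generic qVar where
  ne_zero := RatFunc.X_ne_zero
  pow_ne_one n hn h := by
    have h1 : (X ^ n : ℤ[X]) = 1 := aeval_qVar_injective (by simpa using h)
    have h2 := congrArg natDegree h1
    rw [natDegree_X_pow, natDegree_one] at h2
    exact hn h2

theorem qf_natCast (n : ℕ) : qf qVar n = qFac n := rfl

theorem qi_natCast (n : ℕ) : qi qVar n = (qFac n)⁻¹ := qi_eq_inv qVar n.cast_nonneg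

/-- The fermionic triple-sum forms of the Borwein polynomials `A_L` and `C_L`. -/
theorem theorem9p10 (L : ℕ) :
    aeval qVar (borweinA L) =
      ∑ n ∈ triples (L + 1),
        qVar ^ (bigN₁ n ^ 2 + bigN₂ n ^ 2 + bigN₃ n ^ 2) *
            qFac (L - bigN₁ n) * qFac (2 * L - bigN₁ n - bigN₂ n) /
          (qFac (2 * L - 2 * bigN₁ n) * qFac (L - bigN₁ n - bigN₂ n - bigN₃ n) *
            qFac n.1 * qFac n.2.1 * qFac n.2.2) ∧
    aeval qVar (borweinC L) =
      ∑ n ∈ triples L,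
        qVar ^ (bigN₁ n ^ 2 + bigN₂ n ^ 2 + bigN₃ n ^ 2 + bigN₁ n + bigN₂ n + bigN₃ n) *
            qFac (L - bigN₁ n - 1) * qFac (2 * L - bigN₁ n - bigN₂ n - 1) /
          (qFac (2 * L - 2 * bigN₁ n - 1) * qFac (L - bigN₁ n - bigN₂ n - bigN₃ n - 1) *
            qFac n.1 * qFac n.2.1 * qFac n.2.2) := by
  have hq := generic_qVar
  obtain ⟨hA, hC⟩ := aeval_borwein aeval_qVar_injective hq L
  rw [hA, hC, ← triple_sum_even_eq hq, ← triple_sum_odd_eq hq]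
  constructor
  · symm
    refine sum_triples_eq _ (fun N₁ N₂ N₃ : ℕ => qVar ^ ((N₁ : ℤ) ^ 2 + N₂ ^ 2 + N₃ ^ 2) *
      qf qVar (L - N₁) * qf qVar (2 * L - N₁ - N₂) * qi qVar (2 * L - 2 * N₁) *
      qi qVar (L - N₁ - N₂ - N₃) * qi qVar (N₁ - N₂) * qi qVar (N₂ - N₃) * qi qVar N₃) ?_ ?_
    · intro n hn
      rw [mem_triples] at hn
      have e₁ : n.1 = bigN₁ n - bigN₂ n := by rw [bigN₁, bigN₂]; omega
      have e₂ : n.2.1 = bigN₂ n - bigN₃ n := by rw [bigN₂, bigN₃]; omega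
      have l₁ : bigN₂ n ≤ bigN₁ n := by rw [bigN₁, bigN₂]; omega
      have l₂ : bigN₃ n ≤ bigN₂ n := by rw [bigN₂, bigN₃]; omega
      rw [e₁, e₂, show n.2.2 = bigN₃ n from rfl]
      generalize bigN₁ n = N₁ at *
      generalize bigN₂ n = N₂ at *
      generalize bigN₃ n = N₃ at *
      -- Since N₁ + N₂ + N₃ ≤ L and N₃ ≤ N₂ ≤ N₁, none of the natural-number subtractions truncates.
      rw [show (N₁ : ℤ) ^ 2 + N₂ ^ 2 + N₃ ^ 2 = (N₁ ^ 2 + N₂ ^ 2 + N₃ ^ 2 : ℕ) by push_cast; ring,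
        show (L : ℤ) - N₁ - N₂ - N₃ = (L - N₁ - N₂ - N₃ : ℕ) by omega,
        show (L : ℤ) - N₁ = (L - N₁ : ℕ) by omega,
        show 2 * (L : ℤ) - N₁ - N₂ = (2 * L - N₁ - N₂ : ℕ) by omega,
        show 2 * (L : ℤ) - 2 * N₁ = (2 * L - 2 * N₁ : ℕ) by omega,
        show (N₁ : ℤ) - N₂ = (N₁ - N₂ : ℕ) by omega,
        show (N₂ : ℤ) - N₃ = (N₂ - N₃ : ℕ) by omega]
      simp only [qf_natCast, qi_natCast, zpow_natCast, div_eq_mul_inv, mul_inv]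
      ring
    · intro N₁ N₂ N₃ h
      -- Outside the region, one of N₂-N₃, N₁-N₂, L-N₁-N₂-N₃ is negative and its reciprocal factor
      -- vanishes.
      simp only [mul_eq_zero]
      rcases lt_or_ge N₂ N₃ with h₁ | h₁
      · exact Or.inl (Or.inr (qi_of_neg _ (by omega)))
      rcases lt_or_ge N₁ N₂ with h₂ | h₂
      · exact Or.inl (Or.inl (Or.inr (qi_of_neg _ (by omega))))
      · exact Or.inl (Or.inl (Or.inl (Or.inr (qi_of_neg _ (by omega)))))
  · symm
    refine sum_triples_eq _ (fun N₁ N₂ N₃ : ℕ =>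
      qVar ^ ((N₁ : ℤ) ^ 2 + N₂ ^ 2 + N₃ ^ 2 + N₁ + N₂ + N₃) *
        qf qVar (L - N₁ - 1) * qf qVar (2 * L - N₁ - N₂ - 1) * qi qVar (2 * L - 2 * N₁ - 1) *
        qi qVar (L - N₁ - N₂ - N₃ - 1) * qi qVar (N₁ - N₂) * qi qVar (N₂ - N₃) * qi qVar N₃) ?_ ?_
    · intro n hn
      rw [mem_triples] at hn
      have e₁ : n.1 = bigN₁ n - bigN₂ n := by rw [bigN₁, bigN₂]; omega
      have e₂ : n.2.1 = bigN₂ n - bigN₃ n := by rw [bigN₂, bigN₃]; omega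
      have l₁ : bigN₂ n ≤ bigN₁ n := by rw [bigN₁, bigN₂]; omega
      have l₂ : bigN₃ n ≤ bigN₂ n := by rw [bigN₂, bigN₃]; omega
      rw [e₁, e₂, show n.2.2 = bigN₃ n from rfl]
      generalize bigN₁ n = N₁ at *
      generalize bigN₂ n = N₂ at *
      generalize bigN₃ n = N₃ at *
      rw [show (N₁ : ℤ) ^ 2 + N₂ ^ 2 + N₃ ^ 2 + N₁ + N₂ + N₃ =
          (N₁ ^ 2 + N₂ ^ 2 + N₃ ^ 2 + N₁ + N₂ + N₃ : ℕ) by push_cast; ring,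
        show (L : ℤ) - N₁ - N₂ - N₃ - 1 = (L - N₁ - N₂ - N₃ - 1 : ℕ) by omega,
        show (L : ℤ) - N₁ - 1 = (L - N₁ - 1 : ℕ) by omega,
        show 2 * (L : ℤ) - N₁ - N₂ - 1 = (2 * L - N₁ - N₂ - 1 : ℕ) by omega,
        show 2 * (L : ℤ) - 2 * N₁ - 1 = (2 * L - 2 * N₁ - 1 : ℕ) by omega,
        show (N₁ : ℤ) - N₂ = (N₁ - N₂ : ℕ) by omega,
        show (N₂ : ℤ) - N₃ = (N₂ - N₃ : ℕ) by omega]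
      simp only [qf_natCast, qi_natCast, zpow_natCast, div_eq_mul_inv, mul_inv]
      ring
    · intro N₁ N₂ N₃ h
      simp only [mul_eq_zero]
      rcases lt_or_ge N₂ N₃ with h₁ | h₁
      · exact Or.inl (Or.inr (qi_of_neg _ (by omega)))
      rcases lt_or_ge N₁ N₂ with h₂ | h₂
      · exact Or.inl (Or.inl (Or.inr (qi_of_neg _ (by omega))))
      · exact Or.inl (Or.inl (Or.inl (Or.inr (qi_of_neg _ (by omega)))))
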